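/- **Definitions.** Let $\mathcal D$ be a probability distribution of $(p,y)\in[0,1]\times\{0,1\}$. For a positive integer $m$, let $p'$ be obtained by randomly rounding $p$ up or down to the closest multiple of $1/m$ so that $\mathbb E[p'\mid p,y]=p$ (i.e. $p'=\lceil mp\rceil/m$ with probability $mp-\lfloor mp\rfloor$, and $p'=\lfloor mp\rfloor/m$ otherwise, independently of $y$ given $p$). For $i=0,\dots,m$ put $\pi_i:=\Pr[p'=i/m]$ and $q_i:=\mathbb E[y\mid p'=i/m]$ (irrelevant when $\pi_i=0$), and, with $x_+:=\max\{x,0\}$, $$\mathsf{SCDL}_m(\mathcal D):=\max_{0\le i\le m}\Big(\sum_{j=0}^{i}\pi_j\big(q_j-\tfrac{i+1}{m}\big)_+ +\sum_{j=i+1}^{m}\pi_j\big(\tfrac im-q_j\big)_+\Big),\qquad \mathsf{SCDL}(\mathcal D):=\inf_{m\in\{2^1,2^2,\dots\}}\max\{\mathsf{SCDL}_m(\mathcal D),1/m\}.$$ The distribution $\mathcal D$ is called calibrated if $\mathbb E[y\mid p]=p$ almost surely. **Theorem.** There is an absolute constant $C>0$ such that the following holds for every distribution $\mathcal D$ on $[0,1]\times\{0,1\}$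 and every integer $T\ge 2$. Let $S$ be the uniform distribution over $T$ data points $(p_1,y_1),\dots,(p_T,y_T)$ drawn i.i.d. from $\mathcal D$ ($\log$ is the natural logarithm). 1. For every $\delta\in(e^{-T/2},1/T)$, with probability at least $1-\delta$, $$|\mathsf{SCDL}(S)-\mathsf{SCDL}(\mathcal D)|\le C\sqrt{\frac{\log(1/\delta)}{T}}\,\log\frac{T}{\log(1/\delta)}.$$ 2. If $\mathsf{SCDL}(\mathcal D)=0$, then for every $\delta\in(e^{-T/2},1/T)$, with probability at least $1-\delta$, $$\mathsf{SCDL}(S)\le C\sqrt{\frac{\log(1/\delta)}{T}\,\log\frac{T}{\log(1/\delta)}}.$$ 3. $\mathsf{SCDL}(S)$ is integrable and $\mathbb E|\mathsf{SCDL}(S)-\mathsf{SCDL}(\mathcal D)|\le C\,T^{-1/2}(\log T)^{3/2}$. 4. If $\mathsf{SCDL}(\mathcal D)=0$, then $\mathbb E[\mathsf{SCDL}(S)]\le C\,T^{-1/2}\log T$. If $\mathcal D$ is calibrated, then $\mathbb E|\mathsf{SCDL}(S)-\mathsf{SCDL}(\mathcal D)|\le C\,T^{-1/2}\log T$. -/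

import Mathlib

open MeasureTheory ProbabilityTheory
open scoped ENNReal

noncomputable section

namespace SoftBinned

/-- Prediction-outcome pairs `(p, y) ∈ [0,1] × {0,1}`; the outcome `1` is `true`. -/
abbrev Pair : Type := unitInterval × Bool

/-- The numerical value in `{0,1}` of an outcome. -/
def outcome (y : Bool) : ℝ := if y then 1 else 0

/-- Randomized rounding of `p ∈ [0,1]` to one of the two neighbouring multiples of `1/m`:
up to `⌈mp⌉/m` with probability `mp - ⌊mp⌋`, and down to `⌊mp⌋/m` otherwise
(so that the mean of the rounded value is `p`). -/
def roundMeasure (m : ℕ) (p : unitInterval) : Measure ℝ :=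
  ENNReal.ofReal (1 - Int.fract ((m : ℝ) * p)) • Measure.dirac ((⌊(m : ℝ) * p⌋ : ℝ) / m)
    + ENNReal.ofReal (Int.fract ((m : ℝ) * p)) • Measure.dirac ((⌈(m : ℝ) * p⌉ : ℝ) / m)

theorem measurable_roundMeasure (m : ℕ) : Measurable (roundMeasure m) := by
  refine Measure.measurable_of_measurable_coe _ fun s hs => ?_
  have hp : Measurable fun p : unitInterval => (m : ℝ) * (p : ℝ) := by fun_prop
  have hfl : Measurable fun p : unitInterval => ((⌊(m : ℝ) * p⌋ : ℝ) / m) :=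
    ((measurable_of_countable (fun n : ℤ => (n : ℝ))).comp hp.floor).div_const _
  have hce : Measurable fun p : unitInterval => ((⌈(m : ℝ) * p⌉ : ℝ) / m) :=
    ((measurable_of_countable (fun n : ℤ => (n : ℝ))).comp hp.ceil).div_const _
  simp only [roundMeasure, Measure.add_apply, Measure.smul_apply, smul_eq_mul]
  refine Measurable.add (Measurable.mul ?_ ?_) (Measurable.mul ?_ ?_)
  · exact (measurable_const.sub hp.fract).ennreal_ofReal
  · exact (Measure.measurable_coe hs).comp (Measure.measurable_dirac.comp hfl)
  · exact hp.fract.ennreal_ofReal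
  · exact (Measure.measurable_coe hs).comp (Measure.measurable_dirac.comp hce)

/-- Randomized rounding to multiples of `1/m`, as a Markov kernel. -/
def roundKernel (m : ℕ) : Kernel unitInterval ℝ where
  toFun := roundMeasure m
  measurable' := measurable_roundMeasure m

instance isMarkovKernel_roundKernel (m : ℕ) : IsMarkovKernel (roundKernel m) where
  isProbabilityMeasure p := by
    constructor
    change roundMeasure m p Set.univ = 1
    simp only [roundMeasure, Measure.add_apply, Measure.smul_apply, measure_univ, smul_eq_mul,
      mul_one]
    rw [← ENNReal.ofReal_add (sub_nonneg.2 (Int.fract_lt_one _).le) (Int.fract_nonneg _)]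
    simp

/-- The distribution of `(p', y)`, where `(p, y) ∼ D` and `p'` is the randomized rounding of `p`
to a multiple of `1/m`. -/
def rounded (m : ℕ) (D : Measure Pair) : Measure (ℝ × Bool) :=
  D.bind (Kernel.parallelComp (roundKernel m) (Kernel.id : Kernel Bool Bool))

/-- The event `p' = i/m`. -/
def bin (m i : ℕ) : Set (ℝ × Bool) := {z | z.1 = (i : ℝ) / m}

/-- The weight `π_i = Pr[p' = i/m]`. -/
def binWeight (m : ℕ) (D : Measure Pair) (i : ℕ) : ℝ := (rounded m D).real (bin m i)

/-- The conditional probability `q_i = E[y | p' = i/m]`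
(its value is `0`, and irrelevant, if `π_i = 0`). -/
def binMean (m : ℕ) (D : Measure Pair) (i : ℕ) : ℝ :=
  ∫ z, outcome z.2 ∂(cond (rounded m D) (bin m i))

/-- `∑_{j ≤ i} π_j (q_j - (i+1)/m)_+ + ∑_{i < j ≤ m} π_j (i/m - q_j)_+`. -/
def binLoss (m : ℕ) (D : Measure Pair) (i : ℕ) : ℝ :=
  ∑ j ∈ Finset.Icc 0 i, binWeight m D j * max (binMean m D j - ((i : ℝ) + 1) / m) 0
    + ∑ j ∈ Finset.Icc (i + 1) m, binWeight m D j * max ((i : ℝ) / m - binMean m D j) 0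

/-- `SCDL_m(D)`, the `m`-soft-binned calibration decision loss. -/
def scdlBins (m : ℕ) (D : Measure Pair) : ℝ :=
  (Finset.Icc 0 m).sup' ⟨0, Finset.mem_Icc.2 ⟨le_rfl, Nat.zero_le m⟩⟩ (binLoss m D)

/-- `SCDL(D) = inf_{m ∈ {2^1, 2^2, …}} max {SCDL_m(D), 1/m}`. -/
def SCDL (D : Measure Pair) : ℝ :=
  ⨅ k : ℕ, max (scdlBins (2 ^ (k + 1)) D) (1 / (2 : ℝ) ^ (k + 1))

/-- The uniform distribution over the data points `x_1, …, x_T`. -/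
def empirical {T : ℕ} (x : Fin T → Pair) : Measure Pair :=
  (T : ℝ≥0∞)⁻¹ • ∑ t, Measure.dirac (x t)

/-- The law of `T` i.i.d. draws from `D`. -/
def iidLaw (D : Measure Pair) (T : ℕ) : Measure (Fin T → Pair) :=
  Measure.pi fun _ => D

/-- `D` is (perfectly) calibrated: `E[y | p] = p` almost surely. -/
def IsCalibrated (D : Measure Pair) : Prop :=
  D[fun z : Pair => outcome z.2 | MeasurableSpace.comap (Prod.fst : Pair → unitInterval) inferInstance]
    =ᵐ[D] fun z => (z.1 : ℝ)

end SoftBinned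

end

/-!
Write `a_j = E[tent (m p - j)]` and `b_j = E[y tent (m p - j)]` for the probability that `p` is
rounded to `j/m`, respectively that in addition `y = 1`. Then `π_j (q_j - c)_+ = (b_j - c a_j)_+`,
so the loss at `i` is the `excess` of the sequence `(a, b)` over the threshold `(i+1)/m`, plus that
of the reflected sequence `(a_{m-j}, a_{m-j} - b_{m-j})` over the threshold `(m-i)/m`. All
estimates are made for one excess and used for both.

The two-scale relation of the tent function makes the loss monotone under doubling of the number
of bins (`scdlBins_le_scdlBins_two_mul`). The infimum that defines `SCDL` therefore compares an
increasing with a decreasing sequence, and is decided where the two cross.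

*Lower deviations.* At the crossing index of `D` the loss is the mean of one fixed bounded
function, whose mean under the sample bounds the loss of the sample from below
(`exists_test_function`), so concentration of a single mean suffices.

*Upper deviations.* There is a number of bins `m` with which `D` has nearly its optimal value and
a loss of at most `B/m`, where `B = 6` in general and `B = 0` if `SCDL D = 0`
(`exists_index_upper`). By Bernstein's inequality, all the `a_j` and `b_j` deviate by `O(e √a_j)`,
with `e = O(√(log (1/δ) / T))`, up to lower order terms. Summing these deviations over `m` bins
would lose a factor `√m`. Instead, consider a bin at distance `d/m` from the threshold. If its mean
is at least `d/(4m)` below the threshold, then the deviation is beaten by the gap up to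
`e² m / d`, and these terms add up to `e² m log m`. Otherwise the bin also contributes to the
excesses over the thresholds closer to it; since all of these are at most `B/m`, such bins satisfy
`∑ d a_j = O(B log m)` (`sum_near_mass_mul_dist_le`), and by Cauchy-Schwarz their deviations add up
to `O(e √B log m)`. This is `excess_perturb`. Taking `m` up to order `1/e`, or of order
`1/(e √(log (1/e)))` if `B = 0`, gives the two rates. The bounds in expectation follow with
`δ = 1/T` because `SCDL` is bounded; calibrated distributions have `SCDL D = 0`.
-/

namespace SoftBinned

noncomputable section

/-! ### The tent function -/

/-- The tent function `x ↦ (1 - |x|)_+`; a prediction `p` is rounded to `j/m` with probability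
`tent (m p - j)`. -/
def tent (x : ℝ) : ℝ := max 0 (1 - |x|)

theorem tent_nonneg (x : ℝ) : 0 ≤ tent x := le_max_left _ _

theorem tent_le_one (x : ℝ) : tent x ≤ 1 :=
  max_le zero_le_one (by linarith [abs_nonneg x])

theorem continuous_tent : Continuous tent := by unfold tent; fun_prop

theorem tent_eq_zero {x : ℝ} (h : 1 ≤ |x|) : tent x = 0 := max_eq_left (by linarith)

theorem tent_neg (x : ℝ) : tent (-x) = tent x := by simp [tent]

theorem tent_of_mem {x : ℝ} (h : |x| ≤ 1) : tent x = 1 - |x| := max_eq_right (by linarith)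

/-- The two-scale relation of the tent function. -/
theorem tent_refine (x : ℝ) :
    tent x = tent (2 * x + 1) / 2 + tent (2 * x) + tent (2 * x - 1) / 2 := by
  wlog hx : 0 ≤ x generalizing x
  · have h := this (-x) (by linarith)
    rw [tent_neg, show 2 * -x + 1 = -(2 * x - 1) by ring, show 2 * -x = -(2 * x) by ring,
      show -(2 * x) - 1 = -(2 * x + 1) by ring, tent_neg, tent_neg, tent_neg] at h
    linarith
  rw [tent_eq_zero (x := 2 * x + 1) (by rw [abs_of_nonneg (by linarith)]; linarith)]
  rcases le_total x 1 with h1 | h1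
  · rcases le_total x (1 / 2) with h2 | h2
    · have e1 : |x| = x := abs_of_nonneg hx
      have e2 : |2 * x| = 2 * x := abs_of_nonneg (by linarith)
      have e3 : |2 * x - 1| = 1 - 2 * x := by rw [abs_of_nonpos (by linarith)]; ring
      rw [tent_of_mem (by linarith), tent_of_mem (by linarith), tent_of_mem (by linarith),
        e1, e2, e3]
      ring
    · have e1 : |x| = x := abs_of_nonneg hx
      have e2 : |2 * x| = 2 * x := abs_of_nonneg (by linarith)
      have e3 : |2 * x - 1| = 2 * x - 1 := abs_of_nonneg (by linarith)
      rw [tent_of_mem (by linarith), tent_eq_zero (x := 2 * x) (by linarith),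
        tent_of_mem (by linarith), e1, e3]
      ring
  · rw [tent_eq_zero (x := x) (by rwa [abs_of_nonneg hx]),
      tent_eq_zero (x := 2 * x) (by rw [abs_of_nonneg (by linarith)]; linarith),
      tent_eq_zero (x := 2 * x - 1) (by rw [abs_of_nonneg (by linarith)]; linarith)]
    norm_num

/-- The tent function as a difference of translates, so that sums of its translates telescope. -/
theorem tent_eq_sub (x : ℝ) :
    tent x = min (max (x + 1) 0) 1 - min (max x 0) 1 := by
  unfold tent
  rcases le_total x (-1) with h | h
  · rw [abs_of_nonpos (by linarith), max_eq_left (by linarith), max_eq_right (by linarith),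
      max_eq_right (by linarith)]; simp
  rcases le_total x 0 with h' | h'
  · rw [abs_of_nonpos h', max_eq_right (by linarith), max_eq_left (by linarith),
      max_eq_right (by linarith), min_eq_left (by linarith)]; simp; ring
  rcases le_total x 1 with h1 | h1
  · rw [abs_of_nonneg h', max_eq_right (by linarith), max_eq_left (by linarith),
      max_eq_left (by linarith), min_eq_right (by linarith), min_eq_left h1]
  · rw [abs_of_nonneg h', max_eq_left (by linarith), max_eq_left (by linarith),
      max_eq_left (by linarith), min_eq_right (by linarith), min_eq_right h1]; simp

theorem sum_tent_le_one (x : ℝ) (n : ℕ) : ∑ j ∈ Finset.range n, tent (x - j) ≤ 1 := by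
  have key : ∑ j ∈ Finset.range n, tent (x - j)
      = min (max (x + 1) 0) 1 - min (max (x - n + 1) 0) 1 := by
    induction n with
    | zero => simp
    | succ n ih =>
      rw [Finset.sum_range_succ, ih, tent_eq_sub]
      have : x - ((n + 1 : ℕ) : ℝ) + 1 = x - n := by push_cast; ring
      rw [this]; ring
  rw [key]
  have h1 : min (max (x + 1) 0) (1 : ℝ) ≤ 1 := min_le_right _ _
  have h2 : (0 : ℝ) ≤ min (max (x - n + 1) 0) 1 := le_min (le_max_right _ _) zero_le_one
  linarith

/-! ### Excesses of a sequence of bins -/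

/-- The total amount `∑_{j < n} (b_j - (n/m) a_j)_+` by which the bins `j < n` of masses `a_j`
and outcome masses `b_j` exceed the threshold `n/m`. -/
def excess (m : ℕ) (a b : ℕ → ℝ) (n : ℕ) : ℝ :=
  ∑ j ∈ Finset.range n, max (b j - (n : ℝ) / m * a j) 0

theorem excess_nonneg (m : ℕ) (a b : ℕ → ℝ) (n : ℕ) : 0 ≤ excess m a b n :=
  Finset.sum_nonneg fun _ _ => le_max_right _ _

/-- Merging bins does not increase the sum of positive parts. Only half of the last odd bin
`2 n + 1` goes into the merged bins up to `n`. -/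
theorem sum_pos_merge_le (f g : ℕ → ℝ) (n : ℕ) (h0 : g 0 = f 0 + f 1 / 2)
    (hs : ∀ j < n, g (j + 1) = f (2 * j + 1) / 2 + f (2 * j + 2) + f (2 * j + 3) / 2) :
    ∑ j ∈ Finset.range (n + 1), max (g j) 0
      ≤ ∑ l ∈ Finset.range (2 * n + 1), max (f l) 0 + max (f (2 * n + 1)) 0 / 2 := by
  have hp : ∀ x : ℝ, x ≤ max x 0 := fun x => le_max_left _ _
  have hq : ∀ x : ℝ, 0 ≤ max x 0 := fun x => le_max_right _ _
  induction n with
  | zero =>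
    simp only [zero_add, Finset.sum_range_one, mul_zero]
    refine max_le ?_ (by linarith [hq (f 0), hq (f 1)])
    rw [h0]; linarith [hp (f 0), hp (f 1)]
  | succ n ih =>
    have ih' := ih fun j hj => hs j (by omega)
    rw [Finset.sum_range_succ, show 2 * (n + 1) + 1 = 2 * n + 1 + 1 + 1 by ring,
      Finset.sum_range_succ _ (2 * n + 1 + 1), Finset.sum_range_succ _ (2 * n + 1)]
    have : max (g (n + 1)) 0 ≤ max (f (2 * n + 1)) 0 / 2 + max (f (2 * n + 1 + 1)) 0
        + max (f (2 * n + 1 + 1 + 1)) 0 / 2 := by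
      refine max_le ?_ (by
        linarith [hq (f (2 * n + 1)), hq (f (2 * n + 1 + 1)), hq (f (2 * n + 1 + 1 + 1))])
      rw [hs n (by omega)]
      linarith [hp (f (2 * n + 1)), hp (f (2 * n + 1 + 1)), hp (f (2 * n + 1 + 1 + 1))]
    linarith

/-- The sequence `a` arises, up to index `n`, from the twice finer sequence `a'` by splitting each
odd bin evenly between its even neighbours. The bin `0` has only a right neighbour. -/
def Refines (a a' : ℕ → ℝ) (n : ℕ) : Prop :=
  a 0 = a' 0 + a' 1 / 2 ∧
    ∀ j < n, a (j + 1) = a' (2 * j + 1) / 2 + a' (2 * j + 2) + a' (2 * j + 3) / 2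

/-- The excess over `(n+1)/m` is at most that of the finer bins over the same threshold
`(2n+2)/2m`, and at most that over the lower threshold `(2n+1)/2m` if the bin `2n+1`, which the
latter does not count, does not exceed the threshold. -/
theorem excess_le_excess_refine {m n : ℕ} {a b a' b' : ℕ → ℝ} (hm : 0 < m)
    (ha' : ∀ j, 0 ≤ a' j) (ha : Refines a a' n) (hb : Refines b b' n) :
    excess m a b (n + 1) ≤ excess (2 * m) a' b' (2 * n + 2) ∧
      (b' (2 * n + 1) - ((n + 1 : ℕ) : ℝ) / m * a' (2 * n + 1) ≤ 0 →
        excess m a b (n + 1) ≤ excess (2 * m) a' b' (2 * n + 1)) := by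
  have hm' : (m : ℝ) ≠ 0 := by positivity
  have key := sum_pos_merge_le (fun l => b' l - ((n + 1 : ℕ) : ℝ) / m * a' l)
    (fun j => b j - ((n + 1 : ℕ) : ℝ) / m * a j) n
    (by simp only [ha.1, hb.1]; ring)
    (fun j hj => by simp only [ha.2 j hj, hb.2 j hj]; ring)
  have hc : ((2 * n + 2 : ℕ) : ℝ) / ((2 * m : ℕ) : ℝ) = ((n + 1 : ℕ) : ℝ) / m := by
    push_cast; field_simp
  constructor
  · refine key.trans ?_
    unfold excess
    rw [hc, show 2 * n + 2 = (2 * n + 1) + 1 by ring, Finset.sum_range_succ _ (2 * n + 1)]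
    have : 0 ≤ max (b' (2 * n + 1) - ((n + 1 : ℕ) : ℝ) / m * a' (2 * n + 1)) 0 :=
      le_max_right _ _
    linarith
  · intro h
    refine key.trans ?_
    rw [max_eq_right h, zero_div, add_zero]
    refine Finset.sum_le_sum fun l _ => max_le_max ?_ le_rfl
    have h1 : ((2 * n + 1 : ℕ) : ℝ) / ((2 * m : ℕ) : ℝ) ≤ ((n + 1 : ℕ) : ℝ) / m := by
      rw [← hc]; gcongr; omega
    have := mul_le_mul_of_nonneg_right h1 (ha' l)
    linarith

/-! ### Stability of excesses under small deviations -/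

theorem sum_inv_Icc_eq_harmonic (n : ℕ) :
    ∑ r ∈ Finset.Icc 1 n, ((r : ℝ))⁻¹ = (harmonic n : ℝ) := by
  rw [harmonic_eq_sum_Icc]; push_cast; rfl

theorem harmonic_mono_real {n m : ℕ} (h : n ≤ m) : (harmonic n : ℝ) ≤ harmonic m := by
  rw [← sum_inv_Icc_eq_harmonic, ← sum_inv_Icc_eq_harmonic]
  exact Finset.sum_le_sum_of_subset_of_nonneg (Finset.Icc_subset_Icc_right h)
    fun _ _ _ => by positivity

theorem sum_inv_sub_eq_harmonic (N : ℕ) :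
    ∑ j ∈ Finset.range N, ((N : ℝ) - j)⁻¹ = (harmonic N : ℝ) := by
  rw [harmonic, ← Finset.sum_range_reflect]
  push_cast
  refine Finset.sum_congr rfl fun j hj => ?_
  have hj' := Finset.mem_range.1 hj
  rw [Nat.sub_sub, Nat.cast_sub (by omega)]
  push_cast
  congr 1; ring

/-- A bin at distance `d` below the threshold whose mean is within `d/(4m)` of it exceeds all
the thresholds that are lower by `r/m` with `d/2 ≤ r ≤ d`. -/
theorem mass_mul_dist_le {m d : ℕ} {a x : ℝ} (hm : 0 < m) (ha : 0 ≤ a)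
    (hx : -(d * a / (4 * m)) ≤ x) :
    d * a / (4 * m) ≤ ∑ r ∈ Finset.Icc 1 d, ((r : ℝ))⁻¹ * max (x + r / m * a) 0 := by
  have hm' : (0 : ℝ) < m := by exact_mod_cast hm
  rcases Nat.eq_zero_or_pos d with rfl | hd
  · simp
  calc d * a / (4 * m) ≤ ((Finset.Icc ((d + 1) / 2) d).card : ℝ) * (a / (2 * m)) := by
        have h1 : d ≤ 2 * (Finset.Icc ((d + 1) / 2) d).card := by
          rw [Nat.card_Icc]; omega
        have h2 : (d : ℝ) ≤ 2 * (Finset.Icc ((d + 1) / 2) d).card := by exact_mod_cast h1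
        have h3 : 0 ≤ a / (2 * m) := by positivity
        have h4 : d * a / (4 * m) = (d / 2 : ℝ) * (a / (2 * m)) := by field_simp; ring
        rw [h4]
        exact mul_le_mul_of_nonneg_right (by linarith) h3
    _ = ∑ _r ∈ Finset.Icc ((d + 1) / 2) d, a / (2 * m) := by rw [Finset.sum_const, nsmul_eq_mul]
    _ ≤ ∑ r ∈ Finset.Icc ((d + 1) / 2) d, ((r : ℝ))⁻¹ * max (x + r / m * a) 0 := by
        refine Finset.sum_le_sum fun r hr => ?_
        have hr' := Finset.mem_Icc.1 hr
        have hr0 : 0 < r := by omega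
        have hr0' : (0 : ℝ) < r := by exact_mod_cast hr0
        have hdr : (d : ℝ) ≤ 2 * r := by
          have : d ≤ 2 * r := by omega
          exact_mod_cast this
        have h1 : d * a / (4 * m) ≤ r * a / (2 * m) := by
          rw [div_le_div_iff₀ (by positivity) (by positivity)]
          have := mul_le_mul_of_nonneg_right hdr (mul_nonneg ha hm'.le)
          nlinarith
        have h2 : r * a / (2 * m) ≤ x + r / m * a := by
          have : r / m * a = r * a / (2 * m) + r * a / (2 * m) := by field_simp; ring
          linarith
        calc a / (2 * m) = (r : ℝ)⁻¹ * (r * a / (2 * m)) := by field_simp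
          _ ≤ _ := by
            refine mul_le_mul_of_nonneg_left (h2.trans (le_max_left _ _)) (by positivity)
    _ ≤ _ := by
        refine Finset.sum_le_sum_of_subset_of_nonneg
          (Finset.Icc_subset_Icc_left (by omega)) fun r _ _ => ?_
        exact mul_nonneg (by positivity) (le_max_right _ _)

/-- The bins close to the threshold `(N+1)/m` relative to their distance carry little mass,
because they contribute to the excesses over lower thresholds. -/
theorem sum_near_mass_mul_dist_le {m N : ℕ} {a b : ℕ → ℝ} {B : ℝ} (hm : 0 < m)
    (ha : ∀ j, 0 ≤ a j) (hE : ∀ k ≤ N, excess m a b k ≤ B / m) :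
    ∑ j ∈ (Finset.range N).filter (fun j => -(((N - j : ℕ) : ℝ) * a j / (4 * m))
        < b j - ((N + 1 : ℕ) : ℝ) / m * a j), ((N - j : ℕ) : ℝ) * a j
      ≤ 4 * B * harmonic N := by
  have hm' : (0 : ℝ) < m := by exact_mod_cast hm
  set x : ℕ → ℝ := fun j => b j - ((N + 1 : ℕ) : ℝ) / m * a j with hx
  set s := (Finset.range N).filter (fun j => -(((N - j : ℕ) : ℝ) * a j / (4 * m)) < x j)
    with hs
  have h1 : ∑ j ∈ s, ((N - j : ℕ) : ℝ) * a j / (4 * m) ≤ B / m * harmonic N := by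
    calc ∑ j ∈ s, ((N - j : ℕ) : ℝ) * a j / (4 * m)
        ≤ ∑ j ∈ s, ∑ r ∈ Finset.Icc 1 (N - j), ((r : ℝ))⁻¹ * max (x j + r / m * a j) 0 :=
          Finset.sum_le_sum fun j hj =>
            mass_mul_dist_le hm (ha j) (Finset.mem_filter.1 hj).2.le
      _ ≤ ∑ j ∈ Finset.range N, ∑ r ∈ Finset.Icc 1 (N - j),
            ((r : ℝ))⁻¹ * max (x j + r / m * a j) 0 :=
          Finset.sum_le_sum_of_subset_of_nonneg (Finset.filter_subset _ _) fun j _ _ =>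
            Finset.sum_nonneg fun r _ => mul_nonneg (by positivity) (le_max_right _ _)
      _ = ∑ r ∈ Finset.Icc 1 N, ∑ j ∈ Finset.range (N + 1 - r),
            ((r : ℝ))⁻¹ * max (x j + r / m * a j) 0 := by
          refine Finset.sum_comm' fun j r => ?_
          simp only [Finset.mem_range, Finset.mem_Icc]; omega
      _ = ∑ r ∈ Finset.Icc 1 N, ((r : ℝ))⁻¹ * excess m a b (N + 1 - r) := by
          refine Finset.sum_congr rfl fun r hr => ?_
          have hr' := Finset.mem_Icc.1 hr
          rw [excess, Finset.mul_sum]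
          refine Finset.sum_congr rfl fun j _ => ?_
          rw [Nat.cast_sub (by omega), hx]
          congr 2
          simp only; ring
      _ ≤ ∑ r ∈ Finset.Icc 1 N, ((r : ℝ))⁻¹ * (B / m) := by
          refine Finset.sum_le_sum fun r hr => ?_
          have hr' := Finset.mem_Icc.1 hr
          exact mul_le_mul_of_nonneg_left (hE _ (by omega)) (by positivity)
      _ = B / m * harmonic N := by
          rw [← Finset.sum_mul, sum_inv_Icc_eq_harmonic, mul_comm]
  rw [← Finset.sum_div, div_le_iff₀ (by positivity)] at h1
  refine h1.trans (le_of_eq ?_)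
  field_simp

/-- The effect of a deviation of order `e √a` on a bin of mass `a` at distance `c` from the
threshold: it counts in full only for a bin whose mean is close to the threshold. -/
theorem pos_part_add_le {x x' e a c : ℝ} (ha : 0 ≤ a) (he : 0 ≤ e) (hc : 0 < c)
    (h : x' ≤ x + e * √a + e ^ 2) :
    max x' 0 ≤ max x 0 + e ^ 2 + e ^ 2 / c + if -(c * a / 4) < x then e * √a else 0 := by
  have h1 : 0 ≤ e * √a := by positivity
  have h2 : 0 ≤ e ^ 2 / c := by positivity
  have h3 := le_max_left x 0
  have h4 := le_max_right x 0
  have h5 := sq_nonneg e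
  split_ifs with hb
  · exact max_le (by linarith) (by linarith)
  · refine max_le ?_ (by linarith)
    -- the bin is far below the threshold: its distance absorbs the deviation
    have h6 : e * √a ≤ e ^ 2 / c + c * a / 4 := by
      have h7 : e ^ 2 / c + c * a / 4 - e * √a = (e / c - √a / 2) ^ 2 * c := by
        have h8 := Real.sq_sqrt ha
        field_simp
        nlinarith
      have h8 : 0 ≤ (e / c - √a / 2) ^ 2 * c := by positivity
      linarith
    push Not at hb
    linarith

/-- Bins whose deviations are of the order of the standard deviation `e √a_j` change the excess
by about `e` up to logarithms, provided that the excesses over lower thresholds are `O(1/m)`. -/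
theorem excess_perturb {m n : ℕ} {a b a' b' : ℕ → ℝ} {e B : ℝ} (hm : 0 < m) (hn : n ≤ m + 1)
    (ha : ∀ j, 0 ≤ a j) (ha1 : ∀ j, a j ≤ 1) (he : 0 ≤ e)
    (hdev : ∀ j < n, b' j - (n : ℝ) / m * a' j ≤ b j - (n : ℝ) / m * a j + e * √(a j) + e ^ 2)
    (hE : ∀ k < n, excess m a b k ≤ B / m) :
    excess m a' b' n ≤ excess m a b n
      + (e + e ^ 2 * (m + 1) + e ^ 2 * m * harmonic m + 2 * e * √B * harmonic m) := by
  have hm' : (0 : ℝ) < m := by exact_mod_cast hm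
  have hH : (0 : ℝ) ≤ harmonic m := by
    rw [← sum_inv_Icc_eq_harmonic]; exact Finset.sum_nonneg fun _ _ => by positivity
  rcases n with _ | N
  · simp only [excess, Finset.range_zero, Finset.sum_empty]; positivity
  have hB : 0 ≤ B := by
    have := (excess_nonneg m a b 0).trans (hE 0 (by omega))
    by_contra hB
    exact absurd this (not_le.2 (div_neg_of_neg_of_pos (not_le.1 hB) hm'))
  set x : ℕ → ℝ := fun j => b j - ((N + 1 : ℕ) : ℝ) / m * a j with hx
  set s := (Finset.range N).filter (fun j => -(((N - j : ℕ) : ℝ) * a j / (4 * m)) < x j)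
    with hs
  have hNH : (harmonic N : ℝ) ≤ harmonic m := harmonic_mono_real (by omega)
  have hNm : (N : ℝ) ≤ m := by exact_mod_cast (by omega : N ≤ m)
  have hinv : ∑ j ∈ Finset.range N, (((N - j : ℕ) : ℝ))⁻¹ = (harmonic N : ℝ) := by
    rw [← sum_inv_sub_eq_harmonic]
    refine Finset.sum_congr rfl fun j hj => ?_
    rw [Nat.cast_sub (Finset.mem_range.1 hj).le]
  have hnear := sum_near_mass_mul_dist_le (a := a) (b := b) (B := B) (N := N) hm ha
    fun k hk => hE k (by omega)
  have hsq : ∑ j ∈ s, √(a j) ≤ 2 * √B * harmonic m := by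
    calc ∑ j ∈ s, √(a j)
        = ∑ j ∈ s, √(((N - j : ℕ) : ℝ) * a j) * √((((N - j : ℕ) : ℝ))⁻¹) := by
          refine Finset.sum_congr rfl fun j hj => ?_
          have hj' := Finset.mem_range.1 (Finset.mem_filter.1 hj).1
          have : (0 : ℝ) < ((N - j : ℕ) : ℝ) := by exact_mod_cast (by omega : 0 < N - j)
          rw [← Real.sqrt_mul (mul_nonneg this.le (ha j))]
          congr 1; field_simp
      _ ≤ √(∑ j ∈ s, ((N - j : ℕ) : ℝ) * a j) * √(∑ j ∈ s, (((N - j : ℕ) : ℝ))⁻¹) :=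
          Real.sum_sqrt_mul_sqrt_le _ (fun j => mul_nonneg (Nat.cast_nonneg _) (ha j))
            fun j => by positivity
      _ ≤ √(4 * B * harmonic m) * √(harmonic m) := by
          gcongr
          · exact hnear.trans (mul_le_mul_of_nonneg_left hNH (by positivity))
          · refine le_trans ?_ hNH
            rw [← hinv]
            exact Finset.sum_le_sum_of_subset_of_nonneg (Finset.filter_subset _ _)
              fun _ _ _ => by positivity
      _ = 2 * √B * harmonic m := by
          rw [Real.sqrt_mul (by positivity), Real.sqrt_mul (by norm_num), mul_assoc,
            Real.mul_self_sqrt hH, show (4 : ℝ) = 2 ^ 2 by norm_num,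
            Real.sqrt_sq (by norm_num)]
  have hterm : ∀ j ∈ Finset.range N, max (b' j - ((N + 1 : ℕ) : ℝ) / m * a' j) 0
      ≤ max (x j) 0 + e ^ 2 + e ^ 2 * m * (((N - j : ℕ) : ℝ))⁻¹
        + if -(((N - j : ℕ) : ℝ) * a j / (4 * m)) < x j then e * √(a j) else 0 := by
    intro j hj
    have hj' := Finset.mem_range.1 hj
    have hd : (0 : ℝ) < ((N - j : ℕ) : ℝ) := by exact_mod_cast (by omega : 0 < N - j)
    have := pos_part_add_le (c := ((N - j : ℕ) : ℝ) / m) (ha j) he (by positivity)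
      (hdev j (by omega))
    have e1 : ((N - j : ℕ) : ℝ) / m * a j / 4 = ((N - j : ℕ) : ℝ) * a j / (4 * m) := by
      field_simp
    have e2 : e ^ 2 / (((N - j : ℕ) : ℝ) / m) = e ^ 2 * m * (((N - j : ℕ) : ℝ))⁻¹ := by
      field_simp
    rw [e1, e2] at this
    exact this
  have hlast : max (b' N - ((N + 1 : ℕ) : ℝ) / m * a' N) 0 ≤ max (x N) 0 + e + e ^ 2 := by
    have h0 := hdev N (by omega)
    have h1 : e * √(a N) ≤ e * 1 :=
      mul_le_mul_of_nonneg_left (Real.sqrt_le_one.2 (ha1 N)) he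
    have h2 := le_max_left (x N) 0
    have h3 := le_max_right (x N) 0
    have h4 := sq_nonneg e
    refine max_le ?_ (by linarith)
    have : b N - ((N + 1 : ℕ) : ℝ) / m * a N = x N := rfl
    linarith
  unfold excess
  rw [Finset.sum_range_succ, Finset.sum_range_succ]
  have hsum := Finset.sum_le_sum hterm
  rw [Finset.sum_add_distrib, Finset.sum_add_distrib, Finset.sum_add_distrib, Finset.sum_const,
    ← Finset.mul_sum, hinv, ← Finset.sum_filter, ← Finset.mul_sum, Finset.card_range,
    nsmul_eq_mul] at hsum
  have h1 : e * ∑ j ∈ s, √(a j) ≤ e * (2 * √B * harmonic m) :=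
    mul_le_mul_of_nonneg_left hsq he
  have h2 : e ^ 2 * m * harmonic N ≤ e ^ 2 * m * harmonic m :=
    mul_le_mul_of_nonneg_left hNH (by positivity)
  have h3 : (N : ℝ) * e ^ 2 ≤ m * e ^ 2 := mul_le_mul_of_nonneg_right hNm (sq_nonneg e)
  have hxx : ∀ j, b j - ((N + 1 : ℕ) : ℝ) / m * a j = x j := fun _ => rfl
  simp only [hxx]
  linarith

/-! ### Bin weights as integrals of tent functions -/

/-- The integral of `h y` over the event that `p` is rounded to `j/m`. -/
def binIntegral (h : Bool → ℝ) (m : ℕ) (D : Measure Pair) (j : ℕ) : ℝ :=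
  ∫ z, h z.2 * tent (m * z.1 - j) ∂D

/-- The probability `π_j` that `p` is rounded to `j/m`. -/
abbrev binMass : ℕ → Measure Pair → ℕ → ℝ := binIntegral fun _ => 1

/-- The probability `π_j q_j` that `p` is rounded to `j/m` and `y = 1`. -/
abbrev binHits : ℕ → Measure Pair → ℕ → ℝ := binIntegral outcome

theorem outcome_nonneg (y : Bool) : 0 ≤ outcome y := by unfold outcome; split_ifs <;> norm_num

theorem outcome_le_one (y : Bool) : outcome y ≤ 1 := by unfold outcome; split_ifs <;> norm_num

theorem measurable_binIntegrand (h : Bool → ℝ) (m : ℕ) (c : ℝ) :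
    Measurable fun z : Pair => h z.2 * tent (m * z.1 - c) := by
  have h1 : Measurable h := measurable_of_finite h
  have h2 := continuous_tent.measurable
  fun_prop

theorem integrable_of_measurable_of_abs_le {D : Measure Pair} [IsFiniteMeasure D] {g : Pair → ℝ}
    (hg : Measurable g) {c : ℝ} (hc : ∀ z, |g z| ≤ c) : Integrable g D :=
  Integrable.of_bound hg.aestronglyMeasurable c (Filter.Eventually.of_forall hc)

theorem abs_binIntegrand_le {h : Bool → ℝ} {c : ℝ} (hc : ∀ y, |h y| ≤ c) (x : ℝ) (y : Bool) :
    |h y * tent x| ≤ c * tent x := by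
  rw [abs_mul, abs_of_nonneg (tent_nonneg _)]
  exact mul_le_mul_of_nonneg_right (hc y) (tent_nonneg _)

theorem abs_le_sum_bool (h : Bool → ℝ) (y : Bool) : |h y| ≤ |h true| + |h false| := by
  cases y <;> simp

theorem integrable_binIntegrand (D : Measure Pair) [IsFiniteMeasure D] (h : Bool → ℝ) (m : ℕ)
    (c : ℝ) : Integrable (fun z : Pair => h z.2 * tent (m * z.1 - c)) D := by
  refine integrable_of_measurable_of_abs_le (measurable_binIntegrand h m c)
    (c := |h true| + |h false|) fun z => ?_
  refine (abs_binIntegrand_le (abs_le_sum_bool h) _ _).trans ?_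
  exact mul_le_of_le_one_right (by positivity) (tent_le_one _)

theorem roundMeasure_singleton {m : ℕ} (hm : 0 < m) (p : unitInterval) (j : ℕ) :
    roundMeasure m p {(j : ℝ) / m} = ENNReal.ofReal (tent (m * p - j)) := by
  have hm' : (m : ℝ) ≠ 0 := by positivity
  set x : ℝ := m * p with hx
  have hdiv : ∀ k : ℤ, ((k : ℝ) / m ∈ ({(j : ℝ) / m} : Set ℝ)) ↔ k = (j : ℤ) := by
    intro k
    rw [Set.mem_singleton_iff, div_left_inj' hm']
    exact_mod_cast Iff.rfl
  simp only [roundMeasure, Measure.add_apply, Measure.smul_apply, smul_eq_mul,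
    Measure.dirac_apply' _ (measurableSet_singleton _), Set.indicator_apply, hdiv, ← hx,
    Pi.one_apply]
  have hfl : x = ⌊x⌋ + Int.fract x := (Int.floor_add_fract x).symm
  have hf0 := Int.fract_nonneg x
  have hf1 := Int.fract_lt_one x
  rcases hf0.eq_or_lt with h0 | h0
  · have hce : ⌈x⌉ = ⌊x⌋ := by
      have : x = (⌊x⌋ : ℝ) := by linarith
      rw [this]; simp
    rw [hce, ← h0]
    by_cases hj : ⌊x⌋ = (j : ℤ)
    · have : x - j = 0 := by
        have : (⌊x⌋ : ℝ) = j := by exact_mod_cast hj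
        linarith
      simp [hj, this, tent]
    · have : 1 ≤ |x - j| := by
        have h1 : 1 ≤ |⌊x⌋ - (j : ℤ)| := Int.one_le_abs (sub_ne_zero.2 hj)
        have h2 : x - j = ((⌊x⌋ - (j : ℤ) : ℤ) : ℝ) := by push_cast; linarith
        rw [h2]; exact_mod_cast h1
      simp [hj, tent_eq_zero this]
  · have hce : ⌈x⌉ = ⌊x⌋ + 1 := by
      rw [Int.ceil_eq_iff]; push_cast; constructor <;> linarith
    rw [hce]
    by_cases hj : ⌊x⌋ = (j : ℤ)
    · have h1 : (⌊x⌋ : ℝ) = j := by exact_mod_cast hj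
      have h2 : x - j = Int.fract x := by linarith
      rw [h2, tent, abs_of_pos h0, max_eq_right (by linarith)]
      simp [hj]
    · by_cases hj' : ⌊x⌋ + 1 = (j : ℤ)
      · have h1 : (⌊x⌋ : ℝ) + 1 = j := by exact_mod_cast hj'
        have h2 : x - j = Int.fract x - 1 := by linarith
        rw [h2, tent, abs_of_neg (by linarith), max_eq_right (by linarith)]
        rw [if_neg hj, if_pos hj']
        simp
      · have : 1 ≤ |x - j| := by
          rcases lt_or_gt_of_ne hj with h | h
          · have h3 : ⌊x⌋ + 2 ≤ (j : ℤ) := by omega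
            have h4 : (⌊x⌋ : ℝ) + 2 ≤ j := by exact_mod_cast h3
            rw [abs_of_neg (by linarith)]; linarith
          · have h3 : (j : ℤ) + 1 ≤ ⌊x⌋ := by omega
            have h4 : (j : ℝ) + 1 ≤ ⌊x⌋ := by exact_mod_cast h3
            rw [abs_of_pos (by linarith)]; linarith
        simp [hj, hj', tent_eq_zero this]

theorem rounded_real_prod {m : ℕ} (hm : 0 < m) (D : Measure Pair) [IsProbabilityMeasure D]
    (j : ℕ) (U : Set Bool) :
    (rounded m D).real ({(j : ℝ) / m} ×ˢ U) = binIntegral (U.indicator 1) m D j := by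
  have hU : MeasurableSet U := U.toFinite.measurableSet
  have hs : MeasurableSet (({(j : ℝ) / m} : Set ℝ) ×ˢ U) := (measurableSet_singleton _).prod hU
  have hind : ∀ y, 0 ≤ U.indicator (1 : Bool → ℝ) y :=
    fun y => Set.indicator_nonneg (fun _ _ => zero_le_one) y
  have hint : binIntegral (U.indicator 1) m D j
      = (∫⁻ z, ENNReal.ofReal (U.indicator 1 z.2 * tent (m * z.1 - j)) ∂D).toReal :=
    integral_eq_lintegral_of_nonneg_ae
      (Filter.Eventually.of_forall fun z => mul_nonneg (hind z.2) (tent_nonneg _))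
      (measurable_binIntegrand _ m j).aestronglyMeasurable
  rw [measureReal_def, rounded, Measure.bind_apply hs (Kernel.aemeasurable _), hint]
  congr 1
  refine lintegral_congr fun z => ?_
  rw [Kernel.parallelComp_apply, Measure.prod_prod, Kernel.id_apply,
    Measure.dirac_apply' _ hU, ENNReal.ofReal_mul (hind z.2), mul_comm]
  congr 1
  · by_cases hz : z.2 ∈ U <;> simp [hz]
  · exact roundMeasure_singleton hm z.1 j

theorem bin_eq_prod (m j : ℕ) : bin m j = {(j : ℝ) / m} ×ˢ Set.univ := by
  ext z; simp [bin]

theorem binWeight_eq {m : ℕ} (hm : 0 < m) (D : Measure Pair) [IsProbabilityMeasure D] (j : ℕ) :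
    binWeight m D j = binMass m D j := by
  rw [binWeight, bin_eq_prod, rounded_real_prod hm, Set.indicator_univ]; rfl

theorem binMean_eq {m : ℕ} (hm : 0 < m) (D : Measure Pair) [IsProbabilityMeasure D] (j : ℕ) :
    binMean m D j = (binMass m D j)⁻¹ * binHits m D j := by
  have hout : ∀ z : ℝ × Bool, outcome z.2
      = (Set.univ ×ˢ {true} : Set (ℝ × Bool)).indicator 1 z := by
    rintro ⟨r, y⟩; cases y <;> simp [outcome]
  have hmeas : MeasurableSet (Set.univ ×ˢ {true} : Set (ℝ × Bool)) :=
    MeasurableSet.univ.prod (measurableSet_singleton _)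
  rw [binMean, ProbabilityTheory.cond, integral_smul_measure, smul_eq_mul, ENNReal.toReal_inv]
  congr 1
  · congr 1
    exact binWeight_eq hm D j
  · simp_rw [hout]
    rw [integral_indicator_one hmeas, measureReal_restrict_apply hmeas, bin_eq_prod,
      Set.prod_inter_prod, Set.univ_inter, Set.inter_univ, rounded_real_prod hm]
    unfold binHits
    congr 1
    funext y; cases y <;> simp [outcome]

theorem binIntegral_mono {h h' : Bool → ℝ} (hh : ∀ y, h y ≤ h' y) (m : ℕ) (D : Measure Pair)
    [IsProbabilityMeasure D] (j : ℕ) : binIntegral h m D j ≤ binIntegral h' m D j :=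
  integral_mono (integrable_binIntegrand D h m j) (integrable_binIntegrand D h' m j)
    fun z => mul_le_mul_of_nonneg_right (hh z.2) (tent_nonneg _)

theorem binIntegral_nonneg {h : Bool → ℝ} (hh : ∀ y, 0 ≤ h y) (m : ℕ) (D : Measure Pair)
    (j : ℕ) : 0 ≤ binIntegral h m D j :=
  integral_nonneg fun z => mul_nonneg (hh z.2) (tent_nonneg _)

theorem binMass_nonneg (m : ℕ) (D : Measure Pair) (j : ℕ) : 0 ≤ binMass m D j :=
  binIntegral_nonneg (fun _ => zero_le_one) m D j

theorem binHits_nonneg (m : ℕ) (D : Measure Pair) (j : ℕ) : 0 ≤ binHits m D j :=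
  binIntegral_nonneg outcome_nonneg m D j

theorem binHits_le_binMass (m : ℕ) (D : Measure Pair) [IsProbabilityMeasure D] (j : ℕ) :
    binHits m D j ≤ binMass m D j := binIntegral_mono outcome_le_one m D j

theorem binMass_le_one (m : ℕ) (D : Measure Pair) [IsProbabilityMeasure D] (j : ℕ) :
    binMass m D j ≤ 1 := by
  have := integral_mono (integrable_binIntegrand D (fun _ => 1) m j) (integrable_const (1 : ℝ))
    (fun z => by rw [one_mul]; exact tent_le_one _)
  simpa [binIntegral] using this

theorem binHits_sub_mul_binMass (m : ℕ) (D : Measure Pair) [IsProbabilityMeasure D] (j : ℕ)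
    (c : ℝ) : binHits m D j - c * binMass m D j = binIntegral (fun y => outcome y - c) m D j := by
  simp only [binMass, binHits, binIntegral]
  rw [← integral_const_mul, ← integral_sub (integrable_binIntegrand D outcome m j)
    ((integrable_binIntegrand D (fun _ => 1) m j).const_mul c)]
  refine integral_congr_ae (Filter.Eventually.of_forall fun z => ?_)
  simp only; ring

theorem binMass_sub_binHits_sub_mul (m : ℕ) (D : Measure Pair) [IsProbabilityMeasure D] (j : ℕ)
    (c : ℝ) : binMass m D j - binHits m D j - c * binMass m D j
      = binIntegral (fun y => 1 - outcome y - c) m D j := by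
  simp only [binMass, binHits, binIntegral]
  rw [← integral_const_mul, ← integral_sub
    (integrable_binIntegrand D (fun _ => 1) m j) (integrable_binIntegrand D outcome m j),
    ← integral_sub
      (f := fun z : Pair => 1 * tent (m * z.1 - j) - outcome z.2 * tent (m * z.1 - j))
      ((integrable_binIntegrand D (fun _ => 1) m j).sub (integrable_binIntegrand D outcome m j))
      ((integrable_binIntegrand D (fun _ => 1) m j).const_mul c)]
  refine integral_congr_ae (Filter.Eventually.of_forall fun z => ?_)
  simp only; ring

/-! ### The loss of a bin in terms of excesses -/

/-- The excess of `D` over the threshold `n/m`: the part of the loss caused by bins whose mean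
is too high. -/
def upperExcess (m : ℕ) (D : Measure Pair) (n : ℕ) : ℝ :=
  excess m (binMass m D) (binHits m D) n

/-- The excess of the reflection of `D` under `(p, y) ↦ (1 - p, 1 - y)`: the part of the loss
caused by bins whose mean is too low. -/
def lowerExcess (m : ℕ) (D : Measure Pair) (n : ℕ) : ℝ :=
  excess m (fun j => binMass m D (m - j)) (fun j => binMass m D (m - j) - binHits m D (m - j)) n

theorem upperExcess_nonneg (m : ℕ) (D : Measure Pair) (n : ℕ) : 0 ≤ upperExcess m D n :=
  excess_nonneg _ _ _ _

theorem lowerExcess_nonneg (m : ℕ) (D : Measure Pair) (n : ℕ) : 0 ≤ lowerExcess m D n :=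
  excess_nonneg _ _ _ _

theorem binLoss_eq {m i : ℕ} (hm : 0 < m) (hi : i ≤ m) (D : Measure Pair)
    [IsProbabilityMeasure D] :
    binLoss m D i = upperExcess m D (i + 1) + lowerExcess m D (m - i) := by
  have hm' : (m : ℝ) ≠ 0 := by positivity
  have hzero : ∀ j, binMass m D j = 0 → binHits m D j = 0 := fun j hj =>
    le_antisymm (hj ▸ binHits_le_binMass m D j) (binHits_nonneg m D j)
  have hcancel : ∀ j, binMass m D j * ((binMass m D j)⁻¹ * binHits m D j) = binHits m D j := by
    intro j
    by_cases hj : binMass m D j = 0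
    · rw [hj, hzero j hj]; simp
    · field_simp
  unfold binLoss upperExcess lowerExcess excess
  congr 1
  · rw [← Nat.range_succ_eq_Icc_zero]
    refine Finset.sum_congr rfl fun j _ => ?_
    rw [binWeight_eq hm, binMean_eq hm, mul_max_of_nonneg _ _ (binMass_nonneg m D j), mul_zero,
      mul_sub, hcancel]
    push_cast
    congr 2; ring
  · refine Finset.sum_nbij' (fun j => m - j) (fun j => m - j) ?_ ?_ ?_ ?_ ?_
    · intro j hj; simp only [Finset.mem_Icc, Finset.mem_range] at *; omega
    · intro j hj; simp only [Finset.mem_Icc, Finset.mem_range] at *; omega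
    · intro j hj; simp only [Finset.mem_Icc] at *; omega
    · intro j hj; simp only [Finset.mem_range] at *; omega
    · intro j hj
      have hj' := Finset.mem_Icc.1 hj
      have : m - (m - j) = j := by omega
      simp only [this]
      rw [binWeight_eq hm, binMean_eq hm, mul_max_of_nonneg _ _ (binMass_nonneg m D j),
        mul_zero, mul_sub, hcancel, Nat.cast_sub hi]
      congr 1; field_simp; ring

theorem scdlBins_le_iff {m : ℕ} (hm : 0 < m) (D : Measure Pair) [IsProbabilityMeasure D]
    (c : ℝ) : scdlBins m D ≤ c
      ↔ ∀ i ≤ m, upperExcess m D (i + 1) + lowerExcess m D (m - i) ≤ c := by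
  refine (Finset.sup'_le_iff _ _).trans ?_
  constructor
  · intro h i hi
    rw [← binLoss_eq hm hi]; exact h i (Finset.mem_Icc.2 ⟨Nat.zero_le _, hi⟩)
  · intro h i hi
    have hi' := (Finset.mem_Icc.1 hi).2
    rw [binLoss_eq hm hi']; exact h i hi'

theorem excess_add_le_scdlBins {m : ℕ} (hm : 0 < m) (D : Measure Pair) [IsProbabilityMeasure D]
    {i : ℕ} (hi : i ≤ m) : upperExcess m D (i + 1) + lowerExcess m D (m - i) ≤ scdlBins m D :=
  (scdlBins_le_iff hm D _).1 le_rfl i hi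

theorem scdlBins_nonneg {m : ℕ} (hm : 0 < m) (D : Measure Pair) [IsProbabilityMeasure D] :
    0 ≤ scdlBins m D :=
  (add_nonneg (upperExcess_nonneg _ _ _) (lowerExcess_nonneg _ _ _)).trans
    (excess_add_le_scdlBins hm D (Nat.zero_le m))

theorem upperExcess_le_scdlBins {m : ℕ} (hm : 0 < m) (D : Measure Pair) [IsProbabilityMeasure D]
    {n : ℕ} (hn : n ≤ m + 1) : upperExcess m D n ≤ scdlBins m D := by
  rcases n with _ | n
  · simpa [upperExcess, excess] using scdlBins_nonneg hm D
  · have := excess_add_le_scdlBins hm D (i := n) (by omega)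
    linarith [lowerExcess_nonneg m D (m - n)]

theorem lowerExcess_le_scdlBins {m : ℕ} (hm : 0 < m) (D : Measure Pair) [IsProbabilityMeasure D]
    {n : ℕ} (hn : n ≤ m) : lowerExcess m D n ≤ scdlBins m D := by
  have := excess_add_le_scdlBins hm D (i := m - n) (by omega)
  rw [Nat.sub_sub_self hn] at this
  linarith [upperExcess_nonneg m D (m - n + 1)]

theorem scdlBins_two_le (D : Measure Pair) [IsProbabilityMeasure D] : scdlBins 2 D ≤ 3 := by
  rw [scdlBins_le_iff (by norm_num)]
  have key : ∀ (a b : ℕ → ℝ) (n : ℕ), (∀ j, 0 ≤ a j) → (∀ j, a j ≤ 1) → (∀ j, b j ≤ a j) →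
      excess 2 a b n ≤ n := by
    intro a b n h0 h1 h2
    have : excess 2 a b n ≤ ∑ _j ∈ Finset.range n, (1 : ℝ) := by
      refine Finset.sum_le_sum fun j _ => max_le ?_ zero_le_one
      have : 0 ≤ (n : ℝ) / (2 : ℕ) * a j := mul_nonneg (by positivity) (h0 j)
      linarith [h1 j, h2 j]
    simpa using this
  intro i hi
  have h1 := key (binMass 2 D) (binHits 2 D) (i + 1) (binMass_nonneg 2 D) (binMass_le_one 2 D)
    (binHits_le_binMass 2 D)
  have h2 := key (fun j => binMass 2 D (2 - j)) (fun j => binMass 2 D (2 - j) - binHits 2 D (2 - j))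
    (2 - i) (fun j => binMass_nonneg 2 D _) (fun j => binMass_le_one 2 D _)
    (fun j => by linarith [binHits_nonneg 2 D (2 - j)])
  rw [Nat.cast_sub hi] at h2
  push_cast at h1 h2
  unfold upperExcess lowerExcess
  linarith

/-! ### Monotonicity under refinement of the bins -/

theorem integral_half_add_add_half {D : Measure Pair} {f g k : Pair → ℝ} (hf : Integrable f D)
    (hg : Integrable g D) (hk : Integrable k D) :
    (∫ z, f z ∂D) / 2 + ∫ z, g z ∂D + (∫ z, k z ∂D) / 2 = ∫ z, (f z / 2 + g z + k z / 2) ∂D := by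
  rw [integral_add (f := fun z => f z / 2 + g z) ((hf.div_const 2).add hg) (hk.div_const 2),
    integral_add (hf.div_const 2) hg, integral_div, integral_div]

theorem refines_binIntegral (h : Bool → ℝ) (m : ℕ) (D : Measure Pair) [IsProbabilityMeasure D]
    (n : ℕ) : Refines (binIntegral h m D) (binIntegral h (2 * m) D) n := by
  have hi := fun c => integrable_binIntegrand D h (2 * m) c
  constructor
  · unfold binIntegral
    rw [← integral_div, ← integral_add (hi _) ((hi _).div_const 2)]
    refine integral_congr_ae (Filter.Eventually.of_forall fun z => ?_)
    have h0 : (0 : ℝ) ≤ m * z.1 := mul_nonneg (Nat.cast_nonneg _) z.1.2.1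
    have h1 : tent (2 * (m * z.1) + 1) = 0 :=
      tent_eq_zero (by rw [abs_of_nonneg (by linarith)]; linarith)
    simp only
    rw [Nat.cast_zero, sub_zero, tent_refine, h1]
    push_cast
    rw [sub_zero, ← mul_assoc]; ring
  · intro j _
    unfold binIntegral
    rw [integral_half_add_add_half (hi _) (hi _) (hi _)]
    refine integral_congr_ae (Filter.Eventually.of_forall fun z => ?_)
    simp only
    rw [tent_refine]
    push_cast
    rw [show 2 * ((m : ℝ) * z.1 - (j + 1)) + 1 = 2 * m * z.1 - (2 * j + 1) by ring,
      show 2 * ((m : ℝ) * z.1 - (j + 1)) = 2 * m * z.1 - (2 * j + 2) by ring,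
      show 2 * (m : ℝ) * z.1 - (2 * j + 2) - 1 = 2 * m * z.1 - (2 * j + 3) by ring]
    ring

theorem refines_binIntegral_reflect (h : Bool → ℝ) (m : ℕ) (D : Measure Pair)
    [IsProbabilityMeasure D] {n : ℕ} (hn : n < m) :
    Refines (fun j => binIntegral h m D (m - j)) (fun j => binIntegral h (2 * m) D (2 * m - j))
      n := by
  have hi := fun c => integrable_binIntegrand D h (2 * m) c
  constructor
  · unfold binIntegral
    rw [← integral_div, ← integral_add (hi _) ((hi _).div_const 2)]
    refine integral_congr_ae (Filter.Eventually.of_forall fun z => ?_)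
    have h0 : (m : ℝ) * z.1 ≤ m := mul_le_of_le_one_right (Nat.cast_nonneg _) z.1.2.2
    have h1 : tent (2 * (m * z.1 - m) - 1) = 0 :=
      tent_eq_zero (by rw [abs_of_nonpos (by linarith)]; linarith)
    simp only
    rw [Nat.sub_zero, Nat.sub_zero, Nat.cast_sub (by omega), tent_refine, h1]
    push_cast
    rw [show 2 * ((m : ℝ) * z.1 - m) + 1 = 2 * m * z.1 - (2 * m - 1) by ring,
      show 2 * ((m : ℝ) * z.1 - m) = 2 * m * z.1 - 2 * m by ring]
    ring
  · intro j hj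
    unfold binIntegral
    rw [integral_half_add_add_half (hi _) (hi _) (hi _)]
    refine integral_congr_ae (Filter.Eventually.of_forall fun z => ?_)
    simp only
    rw [tent_refine, Nat.cast_sub (by omega : j + 1 ≤ m),
      Nat.cast_sub (by omega : 2 * j + 1 ≤ 2 * m), Nat.cast_sub (by omega : 2 * j + 2 ≤ 2 * m),
      Nat.cast_sub (by omega : 2 * j + 3 ≤ 2 * m)]
    push_cast
    rw [show 2 * ((m : ℝ) * z.1 - (m - (j + 1))) + 1 = 2 * m * z.1 - (2 * m - (2 * j + 3)) by ring,
      show 2 * ((m : ℝ) * z.1 - (m - (j + 1))) = 2 * m * z.1 - (2 * m - (2 * j + 2)) by ring,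
      show 2 * (m : ℝ) * z.1 - (2 * m - (2 * j + 2)) - 1 = 2 * m * z.1 - (2 * m - (2 * j + 1))
        by ring]
    ring

theorem Refines.sub {a a' b b' : ℕ → ℝ} {n : ℕ} (ha : Refines a a' n) (hb : Refines b b' n) :
    Refines (fun j => a j - b j) (fun j => a' j - b' j) n := by
  refine ⟨?_, fun j hj => ?_⟩
  · simp only [ha.1, hb.1]; ring
  · simp only [ha.2 j hj, hb.2 j hj]; ring

/-- Doubling the number of bins does not decrease the loss: every pair of thresholds
`(i/m, (i+1)/m)` is one of the pairs `(2i/2m, (2i+2)/2m)`, and the middle one of the two finer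
thresholds can be used on the side on which the middle bin does not lose. -/
theorem scdlBins_le_scdlBins_two_mul {m : ℕ} (hm : 0 < m) (D : Measure Pair)
    [IsProbabilityMeasure D] : scdlBins m D ≤ scdlBins (2 * m) D := by
  have hm' : (0 : ℝ) < m := by exact_mod_cast hm
  rw [scdlBins_le_iff hm]
  intro i hi
  have hmass := binMass_nonneg (2 * m) D
  rcases hi.eq_or_lt with rfl | hi
  · have h1 : upperExcess i D (i + 1) = 0 := by
      unfold upperExcess excess
      refine Finset.sum_eq_zero fun j _ => max_eq_right ?_
      have h1 : 1 * binMass i D j ≤ ((i + 1 : ℕ) : ℝ) / i * binMass i D j := by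
        refine mul_le_mul_of_nonneg_right ?_ (binMass_nonneg i D j)
        rw [le_div_iff₀ hm']; push_cast; linarith
      linarith [binHits_le_binMass i D j]
    have h2 : lowerExcess i D (i - i) = 0 := by simp [lowerExcess, excess]
    rw [h1, h2, add_zero]
    exact scdlBins_nonneg (by omega) D
  obtain ⟨n, hn⟩ : ∃ n, m = i + n + 1 := ⟨m - i - 1, by omega⟩
  have hmi : m - i = n + 1 := by omega
  rw [hmi]
  have hU := excess_le_excess_refine (n := i) hm hmass
    (refines_binIntegral (fun _ => 1) m D i) (refines_binIntegral outcome m D i)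
  have hL := excess_le_excess_refine (n := n) hm (fun j => hmass (2 * m - j))
    (refines_binIntegral_reflect (fun _ => 1) m D (by omega))
    ((refines_binIntegral_reflect (fun _ => 1) m D (by omega)).sub
      (refines_binIntegral_reflect outcome m D (by omega)))
  have hidx : 2 * m - (2 * n + 1) = 2 * i + 1 := by omega
  rw [hidx] at hL
  by_cases hc : binHits (2 * m) D (2 * i + 1)
      - ((i + 1 : ℕ) : ℝ) / m * binMass (2 * m) D (2 * i + 1) ≤ 0
  · have h1 := hU.2 hc
    have h2 := hL.1
    have h3 := excess_add_le_scdlBins (by omega : 0 < 2 * m) D (i := 2 * i) (by omega)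
    rw [show 2 * m - 2 * i = 2 * n + 2 by omega] at h3
    exact (add_le_add h1 h2).trans h3
  · have h1 := hU.1
    have h2 := hL.2 (by
      have h4 : ((i + 1 : ℕ) : ℝ) / m + ((n + 1 : ℕ) : ℝ) / m = 1 + 1 / m := by
        rw [hn]; push_cast; field_simp; ring
      have h5 : 0 ≤ (1 / (m : ℝ)) * binMass (2 * m) D (2 * i + 1) :=
        mul_nonneg (by positivity) (hmass _)
      have h6 : ((n + 1 : ℕ) : ℝ) / m * binMass (2 * m) D (2 * i + 1)
          = (1 + 1 / m - ((i + 1 : ℕ) : ℝ) / m) * binMass (2 * m) D (2 * i + 1) := by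
        rw [← h4]; ring
      push Not at hc
      rw [h6]; linarith)
    have h3 := excess_add_le_scdlBins (by omega : 0 < 2 * m) D (i := 2 * i + 1) (by omega)
    rw [show 2 * m - (2 * i + 1) = 2 * n + 1 by omega] at h3
    exact (add_le_add h1 h2).trans h3

/-! ### A Bernstein inequality for empirical means -/

instance isProbabilityMeasure_iidLaw (D : Measure Pair) [IsProbabilityMeasure D] (T : ℕ) :
    IsProbabilityMeasure (iidLaw D T) := by unfold iidLaw; infer_instance

/-- The mean of `g` over a sample. -/
def sampleMean {T : ℕ} (g : Pair → ℝ) (x : Fin T → Pair) : ℝ := (T : ℝ)⁻¹ * ∑ t, g (x t)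

theorem measurable_sampleMean {T : ℕ} {g : Pair → ℝ} (hg : Measurable g) :
    Measurable (sampleMean g : (Fin T → Pair) → ℝ) := by unfold sampleMean; fun_prop

theorem integral_empirical {T : ℕ} (x : Fin T → Pair) {g : Pair → ℝ} (hg : Measurable g) :
    ∫ z, g z ∂(empirical x) = sampleMean g x := by
  unfold empirical sampleMean
  rw [integral_smul_measure, integral_finsetSum_measure, smul_eq_mul]
  · simp [integral_dirac' _ _ hg.stronglyMeasurable]
  · intro t _
    exact integrable_dirac' hg.stronglyMeasurable (by simp)

theorem isProbabilityMeasure_empirical {T : ℕ} (hT : 0 < T) (x : Fin T → Pair) :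
    IsProbabilityMeasure (empirical x) := by
  constructor
  simp only [empirical, Measure.smul_apply, Measure.finsetSum_apply, measure_univ, smul_eq_mul,
    Finset.sum_const, Finset.card_univ, Fintype.card_fin, nsmul_eq_mul, mul_one]
  exact ENNReal.inv_mul_cancel (by exact_mod_cast hT.ne') (ENNReal.natCast_ne_top T)

theorem integral_exp_mul_le {D : Measure Pair} [IsProbabilityMeasure D] {g : Pair → ℝ}
    (hg : Measurable g) (h0 : ∀ z, 0 ≤ g z) (h1 : ∀ z, g z ≤ 1) {s : ℝ} (hs : |s| ≤ 1) :
    ∫ z, Real.exp (s * g z) ∂D ≤ Real.exp ((s + s ^ 2) * ∫ z, g z ∂D) := by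
  have hgi : Integrable g D := Integrable.of_bound hg.aestronglyMeasurable 1
    (Filter.Eventually.of_forall fun z => by
      rw [Real.norm_eq_abs, abs_of_nonneg (h0 z)]; exact h1 z)
  have hpt : ∀ z, Real.exp (s * g z) ≤ 1 + (s + s ^ 2) * g z := by
    intro z
    have habs : |s * g z| ≤ 1 := by
      rw [abs_mul, abs_of_nonneg (h0 z)]
      exact mul_le_one₀ hs (h0 z) (h1 z)
    have h2 := (abs_le.1 (Real.abs_exp_sub_one_sub_id_le habs)).2
    have h3 : (s * g z) ^ 2 ≤ s ^ 2 * g z := by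
      rw [mul_pow]
      exact mul_le_mul_of_nonneg_left (by nlinarith [h0 z, h1 z]) (sq_nonneg s)
    linarith
  have hexp : Integrable (fun z => Real.exp (s * g z)) D := by
    refine Integrable.of_bound (by fun_prop) (Real.exp 1) (Filter.Eventually.of_forall fun z => ?_)
    rw [Real.norm_eq_abs, Real.abs_exp]
    refine Real.exp_le_exp.2 ((le_abs_self _).trans ?_)
    rw [abs_mul, abs_of_nonneg (h0 z)]
    exact mul_le_one₀ hs (h0 z) (h1 z)
  calc ∫ z, Real.exp (s * g z) ∂D ≤ ∫ z, (1 + (s + s ^ 2) * g z) ∂D :=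
        integral_mono hexp ((integrable_const _).add (hgi.const_mul _)) hpt
    _ = 1 + (s + s ^ 2) * ∫ z, g z ∂D := by
        rw [integral_add (integrable_const _) (hgi.const_mul _), integral_const_mul]; simp
    _ ≤ _ := by linarith [Real.add_one_le_exp ((s + s ^ 2) * ∫ z, g z ∂D)]

theorem integral_exp_sum {D : Measure Pair} [IsProbabilityMeasure D] {T : ℕ} (g : Pair → ℝ) :
    ∫ x, Real.exp (∑ t, g (x t)) ∂(iidLaw D T) = (∫ z, Real.exp (g z) ∂D) ^ T := by
  simp_rw [Real.exp_sum]
  have h := integral_fintype_prod_eq_pow (ι := Fin T) (μ := D) (𝕜 := ℝ)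
    (fun z => Real.exp (g z))
  rw [Fintype.card_fin] at h
  exact h

theorem integrable_exp_sum {D : Measure Pair} [IsProbabilityMeasure D] {T : ℕ} {g : Pair → ℝ}
    (hg : Measurable g) (h1 : ∀ z, g z ≤ 1) :
    Integrable (fun x : Fin T → Pair => Real.exp (∑ t, g (x t))) (iidLaw D T) := by
  have hmeas : Measurable fun x : Fin T → Pair => ∑ t, g (x t) :=
    Finset.measurable_sum _ fun t _ => hg.comp (measurable_pi_apply t)
  refine Integrable.of_bound hmeas.exp.aestronglyMeasurable (Real.exp T)
    (Filter.Eventually.of_forall fun x => ?_)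
  rw [Real.norm_eq_abs, Real.abs_exp]
  refine Real.exp_le_exp.2 ?_
  calc ∑ t, g (x t) ≤ ∑ _t : Fin T, (1 : ℝ) := Finset.sum_le_sum fun t _ => h1 _
    _ = T := by simp

/-- The Chernoff bound with parameter `s`, of either sign. -/
theorem chernoff_sum {D : Measure Pair} [IsProbabilityMeasure D] {T : ℕ} {g : Pair → ℝ}
    (hg : Measurable g) (h0 : ∀ z, 0 ≤ g z) (h1 : ∀ z, g z ≤ 1) {s : ℝ} (hs : |s| ≤ 1) (c : ℝ) :
    (iidLaw D T).real {x | c ≤ ∑ t, s * g (x t)}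
      ≤ Real.exp (-c + T * ((s + s ^ 2) * ∫ z, g z ∂D)) := by
  have hsg : ∀ z, s * g z ≤ 1 := fun z => by
    refine (le_abs_self _).trans ?_
    rw [abs_mul, abs_of_nonneg (h0 z)]
    exact mul_le_one₀ hs (h0 z) (h1 z)
  have hint := integrable_exp_sum (D := D) (T := T) (hg.const_mul s) hsg
  have hmain := measure_ge_le_exp_mul_mgf (μ := iidLaw D T)
    (X := fun x => ∑ t, s * g (x t)) (t := 1) c zero_le_one (by simpa only [one_mul] using hint)
  rw [mgf] at hmain
  simp only [one_mul] at hmain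
  rw [integral_exp_sum fun z => s * g z] at hmain
  refine hmain.trans ?_
  rw [Real.exp_add, neg_one_mul, Real.exp_nat_mul]
  exact mul_le_mul_of_nonneg_left (pow_le_pow_left₀ (integral_nonneg fun _ => (Real.exp_pos _).le)
    (integral_exp_mul_le hg h0 h1 hs) T) (Real.exp_pos _).le

/-- Choice of the Chernoff parameter. -/
theorem exists_chernoff_param {M L : ℝ} (hL : 0 < L) :
    ∃ s : ℝ, 0 ≤ s ∧ s ≤ 1 ∧ s ^ 2 * M + L ≤ s * (2 * √(M * L) + 2 * L) := by
  rcases le_total M L with h | h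
  · refine ⟨1, zero_le_one, le_rfl, ?_⟩
    have := Real.sqrt_nonneg (M * L)
    linarith
  · have hM' : 0 < M := hL.trans_le h
    refine ⟨√(L / M), Real.sqrt_nonneg _, Real.sqrt_le_one.2 ((div_le_one hM').2 h), ?_⟩
    have h1 : √(L / M) * √(M * L) = L := by
      rw [← Real.sqrt_mul (by positivity), show L / M * (M * L) = L ^ 2 by field_simp,
        Real.sqrt_sq hL.le]
    rw [Real.sq_sqrt (by positivity)]
    have h2 : L / M * M = L := by field_simp
    have h3 : 0 ≤ √(L / M) * L := by positivity
    nlinarith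

/-- Bernstein's inequality: the mean of `T` draws of a `[0,1]`-valued variable of mean at most `M`
deviates by at least `2 √(M L / T) + 2 L / T` with probability at most `2 e^{-L}`. -/
theorem bernstein {D : Measure Pair} [IsProbabilityMeasure D] {T : ℕ} (hT : 0 < T)
    {g : Pair → ℝ} (hg : Measurable g) (h0 : ∀ z, 0 ≤ g z) (h1 : ∀ z, g z ≤ 1) {M L : ℝ}
    (hM : ∫ z, g z ∂D ≤ M) (hL : 0 < L) :
    (iidLaw D T).real {x | 2 * √(M * (L / T)) + 2 * (L / T)
      ≤ |sampleMean g x - ∫ z, g z ∂D|} ≤ 2 * Real.exp (-L) := by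
  have hT' : (0 : ℝ) < T := by exact_mod_cast hT
  set μ := ∫ z, g z ∂D with hμ
  have hμ0 : 0 ≤ μ := integral_nonneg h0
  have hM0 : 0 ≤ M := hμ0.trans hM
  obtain ⟨s, hs0, hs1, hs⟩ := exists_chernoff_param (M := T * M) (L := L) hL
  set τ : ℝ := 2 * √(M * (L / T)) + 2 * (L / T) with hτ
  have hτT : 2 * √(T * M * L) + 2 * L = T * τ := by
    have : √(T * M * L) = T * √(M * (L / T)) := by
      rw [show (T : ℝ) * M * L = T ^ 2 * (M * (L / T)) by field_simp,
        Real.sqrt_mul (by positivity), Real.sqrt_sq hT'.le]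
    rw [this, hτ]; field_simp
  rw [hτT] at hs
  have habs : |s| ≤ 1 := by rwa [abs_of_nonneg hs0]
  have hup := chernoff_sum (D := D) (T := T) hg h0 h1 habs (s * (T * (μ + τ)))
  have hlo := chernoff_sum (D := D) (T := T) hg h0 h1 (s := -s) (by rwa [abs_neg])
    (-s * (T * (μ - τ)))
  have hMμ : s ^ 2 * (T * μ) ≤ s ^ 2 * (T * M) := by gcongr
  have hup' : Real.exp (-(s * (T * (μ + τ))) + T * ((s + s ^ 2) * μ)) ≤ Real.exp (-L) :=
    Real.exp_le_exp.2 (by nlinarith)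
  have hlo' : Real.exp (-(-s * (T * (μ - τ))) + T * ((-s + (-s) ^ 2) * μ)) ≤ Real.exp (-L) :=
    Real.exp_le_exp.2 (by nlinarith)
  have hsub : {x : Fin T → Pair | τ ≤ |sampleMean g x - μ|}
      ⊆ {x | s * (T * (μ + τ)) ≤ ∑ t, s * g (x t)}
        ∪ {x | -s * (T * (μ - τ)) ≤ ∑ t, -s * g (x t)} := by
    intro x hx
    have hsum : ∑ t, g (x t) = T * sampleMean g x := by
      unfold sampleMean; field_simp
    simp only [Set.mem_union, Set.mem_ofPred_eq, ← Finset.mul_sum, hsum] at hx ⊢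
    rcases le_abs.1 hx with h | h
    · left
      exact mul_le_mul_of_nonneg_left (mul_le_mul_of_nonneg_left (by linarith) hT'.le) hs0
    · right
      have : T * sampleMean g x ≤ T * (μ - τ) := mul_le_mul_of_nonneg_left (by linarith) hT'.le
      nlinarith
  calc _ ≤ _ := measureReal_mono hsub
    _ ≤ _ := measureReal_union_le _ _
    _ ≤ 2 * Real.exp (-L) := by linarith

/-! ### The infimum over the numbers of bins -/

/-- The value `inf_k max {s_k, 2^{-(k+1)}}` of a sequence of losses. -/
def levelValue (s : ℕ → ℝ) : ℝ := ⨅ k : ℕ, max (s k) (1 / (2 : ℝ) ^ (k + 1))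

theorem levelValue_le (s : ℕ → ℝ) (k : ℕ) : levelValue s ≤ max (s k) (1 / (2 : ℝ) ^ (k + 1)) :=
  ciInf_le ⟨0, by rintro _ ⟨k, rfl⟩; exact le_max_of_le_right (by positivity)⟩ k

theorem le_levelValue {s : ℕ → ℝ} {c : ℝ} (h : ∀ k, c ≤ max (s k) (1 / (2 : ℝ) ^ (k + 1))) :
    c ≤ levelValue s := le_ciInf h

theorem levelValue_nonneg (s : ℕ → ℝ) : 0 ≤ levelValue s :=
  le_levelValue fun _ => le_max_of_le_right (by positivity)

theorem one_div_two_pow_anti {j k : ℕ} (h : j ≤ k) :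
    1 / (2 : ℝ) ^ k ≤ 1 / (2 : ℝ) ^ j :=
  one_div_le_one_div_of_le (by positivity) (pow_le_pow_right₀ one_le_two h)

theorem levelValue_le_of_forall_lt {s : ℕ → ℝ} (h : ∀ k, s k < 1 / (2 : ℝ) ^ (k + 1)) :
    levelValue s ≤ 0 := by
  have hlim : Filter.Tendsto (fun k : ℕ => (1 / 2 : ℝ) ^ (k + 1)) Filter.atTop (nhds 0) :=
    (tendsto_pow_atTop_nhds_zero_of_lt_one (by norm_num) (by norm_num)).comp
      (Filter.tendsto_add_atTop_nat 1)
  refine ge_of_tendsto' hlim fun k => ?_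
  rw [one_div_pow]
  exact (levelValue_le s k).trans (max_le (h k).le le_rfl)

/-- The value of a monotone sequence is bounded below through a single index: the first at which
the sequence reaches `2^{-(k+1)}`. -/
theorem exists_index_lower {s : ℕ → ℝ} : ∃ k₀, ∀ s' : ℕ → ℝ, Monotone s' →
    ∀ ε : ℝ, 0 ≤ ε → s k₀ - ε ≤ s' k₀ → levelValue s - ε ≤ levelValue s' := by
  classical
  by_cases hex : ∃ k, 1 / (2 : ℝ) ^ (k + 1) ≤ s k
  · refine ⟨Nat.find hex, fun s' hs' ε hε h => le_levelValue fun k => ?_⟩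
    rcases le_or_gt (Nat.find hex) k with hk | hk
    · have h1 := levelValue_le s (Nat.find hex)
      rw [max_eq_left (Nat.find_spec hex)] at h1
      exact le_max_of_le_left (by linarith [hs' hk])
    · obtain ⟨n, hn⟩ : ∃ n, Nat.find hex = n + 1 := ⟨Nat.find hex - 1, by omega⟩
      have h1 := levelValue_le s n
      rw [max_eq_right (not_le.1 (Nat.find_min hex (by omega : n < Nat.find hex))).le] at h1
      have h2 := one_div_two_pow_anti (by omega : k + 1 ≤ n + 1)
      exact le_max_of_le_right (by linarith)
  · push Not at hex
    exact ⟨0, fun s' _ ε hε _ => by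
      linarith [levelValue_le_of_forall_lt hex, levelValue_nonneg s']⟩

/-- Up to `2^{-(K+1)}`, the value of a monotone sequence is attained at an index `k ≤ K` with
`s_k = O(2^{-k})`. -/
theorem exists_index_upper {s : ℕ → ℝ} (hs : Monotone s) (h0 : s 0 ≤ 3) (K : ℕ) :
    ∃ k ≤ K, max (s k) (1 / (2 : ℝ) ^ (k + 1)) ≤ levelValue s + 1 / (2 : ℝ) ^ (K + 1) ∧
      s k ≤ 6 / (2 : ℝ) ^ (k + 1) := by
  classical
  have hpos : ∀ k : ℕ, 0 < 1 / (2 : ℝ) ^ k := fun k => by positivity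
  have hsix : ∀ k : ℕ, 6 / (2 : ℝ) ^ k = 6 * (1 / (2 : ℝ) ^ k) := fun k => by ring
  have hv := levelValue_nonneg s
  by_cases hex : ∃ k ≤ K, 1 / (2 : ℝ) ^ (k + 1) ≤ s k
  · obtain ⟨hfK, hf⟩ := Nat.find_spec hex
    set f := Nat.find hex with hfdef
    have hmin : ∀ n < f, s n < 1 / (2 : ℝ) ^ (n + 1) := fun n hn => by
      have := Nat.find_min hex hn
      push Not at this
      exact this (by omega)
    rcases Nat.eq_zero_or_pos f with hf0 | hf0
    · refine ⟨0, Nat.zero_le _, ?_, by rw [zero_add, pow_one]; linarith⟩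
      rw [hf0] at hf
      have : s 0 ≤ levelValue s := le_levelValue fun k => le_max_of_le_left (hs (Nat.zero_le k))
      rw [max_eq_left hf]; linarith [hpos (K + 1)]
    · obtain ⟨n, hn⟩ : ∃ n, f = n + 1 := ⟨f - 1, by omega⟩
      have hsn := hmin n (by omega)
      have hhalf : 1 / (2 : ℝ) ^ (n + 1) = 2 * (1 / (2 : ℝ) ^ (n + 1 + 1)) := by
        rw [pow_succ 2 (n + 1)]; field_simp
      rw [hn] at hf hfK
      rcases le_total (s (n + 1)) (1 / (2 : ℝ) ^ (n + 1)) with hle | hle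
      · refine ⟨n + 1, hfK, ?_, by rw [hsix]; linarith [hpos (n + 1 + 1)]⟩
        have : s (n + 1) ≤ levelValue s := le_levelValue fun k => by
          rcases le_or_gt (n + 1) k with hk | hk
          · exact le_max_of_le_left (hs hk)
          · exact le_max_of_le_right (hle.trans (one_div_two_pow_anti (by omega)))
        rw [max_eq_left hf]; linarith [hpos (K + 1)]
      · refine ⟨n, by omega, ?_, by rw [hsix]; linarith [hpos (n + 1)]⟩
        have : 1 / (2 : ℝ) ^ (n + 1) ≤ levelValue s := le_levelValue fun k => by
          rcases le_or_gt (n + 1) k with hk | hk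
          · exact le_max_of_le_left (hle.trans (hs hk))
          · exact le_max_of_le_right (one_div_two_pow_anti (by omega))
        rw [max_eq_right hsn.le]; linarith [hpos (K + 1)]
  · push Not at hex
    have := hex K le_rfl
    refine ⟨K, le_rfl, ?_, by rw [hsix]; linarith [hpos (K + 1)]⟩
    rw [max_eq_right this.le]; linarith

theorem eq_zero_of_levelValue_eq_zero {s : ℕ → ℝ} (hs : Monotone s) (h0 : ∀ k, 0 ≤ s k)
    (h : levelValue s = 0) (k : ℕ) : s k = 0 := by
  by_contra hk
  have hk' : 0 < s k := lt_of_le_of_ne (h0 k) (Ne.symm hk)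
  have h1 : 0 < min (s k) (1 / (2 : ℝ) ^ (k + 1)) := lt_min hk' (by positivity)
  have h2 : min (s k) (1 / (2 : ℝ) ^ (k + 1)) ≤ levelValue s := le_levelValue fun j => by
    rcases le_total k j with hj | hj
    · exact (min_le_left _ _).trans (le_max_of_le_left (hs hj))
    · exact (min_le_right _ _).trans
        (le_max_of_le_right (one_div_two_pow_anti (by omega)))
  linarith

/-- The losses of `D` with `2, 4, 8, …` bins. -/
def dyadicLoss (D : Measure Pair) (k : ℕ) : ℝ := scdlBins (2 ^ (k + 1)) D

theorem SCDL_eq_levelValue (D : Measure Pair) : SCDL D = levelValue (dyadicLoss D) := rfl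

theorem monotone_dyadicLoss (D : Measure Pair) [IsProbabilityMeasure D] :
    Monotone (dyadicLoss D) := by
  refine monotone_nat_of_le_succ fun k => ?_
  unfold dyadicLoss
  rw [pow_succ 2 (k + 1), mul_comm]
  exact scdlBins_le_scdlBins_two_mul (by positivity) D

theorem dyadicLoss_nonneg (D : Measure Pair) [IsProbabilityMeasure D] (k : ℕ) :
    0 ≤ dyadicLoss D k := scdlBins_nonneg (by positivity) D

theorem dyadicLoss_zero_le (D : Measure Pair) [IsProbabilityMeasure D] : dyadicLoss D 0 ≤ 3 :=
  scdlBins_two_le D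

theorem SCDL_nonneg (D : Measure Pair) : 0 ≤ SCDL D := levelValue_nonneg _

theorem SCDL_le_three (D : Measure Pair) [IsProbabilityMeasure D] : SCDL D ≤ 3 :=
  (levelValue_le _ 0).trans (max_le (dyadicLoss_zero_le D) (by norm_num))

/-! ### Calibrated distributions -/

/-- The σ-algebra generated by the prediction. -/
abbrev predictionAlgebra : MeasurableSpace Pair :=
  MeasurableSpace.comap (Prod.fst : Pair → unitInterval) inferInstance

theorem integral_outcome_mul_of_isCalibrated {D : Measure Pair} [IsProbabilityMeasure D]
    (hD : IsCalibrated D) (m j : ℕ) :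
    binHits m D j = ∫ z, (z.1 : ℝ) * tent (m * z.1 - j) ∂D := by
  have hle : predictionAlgebra ≤ Prod.instMeasurableSpace := measurable_fst.comap_le
  have hout : Measurable fun z : Pair => outcome z.2 :=
    (measurable_of_finite outcome).comp measurable_snd
  have hout_int : Integrable (fun z : Pair => outcome z.2) D :=
    integrable_of_measurable_of_abs_le hout (c := 1) fun z => by
      rw [abs_of_nonneg (outcome_nonneg _)]; exact outcome_le_one _
  set w : Pair → ℝ := fun z => tent (m * z.1 - j) with hw
  have hwm : StronglyMeasurable[predictionAlgebra] w := by
    have h1 : Measurable fun p : unitInterval => tent (m * p - j) := by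
      have := continuous_tent.measurable
      fun_prop
    exact (h1.comp (comap_measurable (Prod.fst : Pair → unitInterval))).stronglyMeasurable
  have hprod : Integrable (w * fun z : Pair => outcome z.2) D := by
    refine (integrable_binIntegrand D outcome m j).congr (Filter.Eventually.of_forall fun z => ?_)
    simp only [Pi.mul_apply, hw, mul_comm]
  have hpull := condExp_mul_of_stronglyMeasurable_left hwm hprod hout_int
  calc binHits m D j = ∫ z, (w * fun z : Pair => outcome z.2) z ∂D := by
        refine integral_congr_ae (Filter.Eventually.of_forall fun z => ?_)
        simp only [Pi.mul_apply, hw, mul_comm]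
    _ = ∫ z, (D[w * fun z : Pair => outcome z.2 | predictionAlgebra]) z ∂D :=
        (integral_condExp hle).symm
    _ = ∫ z, (z.1 : ℝ) * tent (m * z.1 - j) ∂D := by
        refine integral_congr_ae ?_
        filter_upwards [hpull, hD] with z h1 h2
        rw [h1, Pi.mul_apply, h2, mul_comm]

theorem scdlBins_eq_zero_of_isCalibrated {D : Measure Pair} [IsProbabilityMeasure D]
    (hD : IsCalibrated D) {m : ℕ} (hm : 0 < m) : scdlBins m D = 0 := by
  have hm' : (0 : ℝ) < m := by exact_mod_cast hm
  refine le_antisymm ((scdlBins_le_iff hm D 0).2 fun i hi => ?_) (scdlBins_nonneg hm D)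
  have hp : ∀ j : ℕ, Integrable (fun z : Pair => (z.1 : ℝ) * tent (m * z.1 - j)) D := fun j => by
    have h1 := continuous_tent.measurable
    refine integrable_of_measurable_of_abs_le (by fun_prop) (c := 1) fun z => ?_
    rw [abs_of_nonneg (mul_nonneg z.1.2.1 (tent_nonneg _))]
    exact mul_le_one₀ z.1.2.2 (tent_nonneg _) (tent_le_one _)
  have hc : ∀ (c : ℝ) (j : ℕ), Integrable (fun z : Pair => c * tent (m * z.1 - j)) D :=
    fun c j => integrable_binIntegrand D (fun _ => c) m j
  have hmass : ∀ (c : ℝ) (j : ℕ), c * binMass m D j = ∫ z, c * tent (m * z.1 - j) ∂D := by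
    intro c j; simp only [binMass, binIntegral, one_mul, integral_const_mul]
  -- on the support of its tent, the prediction `p` is within `1/m` of `j/m`
  have hsupp : ∀ (x : ℝ) (j : ℕ), tent (m * x - j) = 0 ∨
      (m * x ≤ j + 1 ∧ (j : ℝ) - 1 ≤ m * x) := by
    intro x j
    rcases le_total 1 |(m : ℝ) * x - j| with h | h
    · exact Or.inl (tent_eq_zero h)
    · right; constructor <;> linarith [(abs_le.1 h).1, (abs_le.1 h).2]
  have hU : upperExcess m D (i + 1) = 0 := by
    unfold upperExcess excess
    refine Finset.sum_eq_zero fun j hj => max_eq_right ?_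
    have hj' : (j : ℝ) + 1 ≤ ((i + 1 : ℕ) : ℝ) := by
      exact_mod_cast Finset.mem_range.1 hj
    rw [integral_outcome_mul_of_isCalibrated hD, hmass, sub_nonpos]
    refine integral_mono (hp j) (hc _ j) fun z => ?_
    rcases hsupp z.1 j with h | h
    · simp [h]
    · refine mul_le_mul_of_nonneg_right ?_ (tent_nonneg _)
      rw [le_div_iff₀ hm']; linarith [h.1]
  have hL : lowerExcess m D (m - i) = 0 := by
    unfold lowerExcess excess
    refine Finset.sum_eq_zero fun j hj => max_eq_right ?_
    have hj1 := Finset.mem_range.1 hj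
    have hj' : (i : ℝ) ≤ ((m - j : ℕ) : ℝ) - 1 := by
      have h1 : i + 1 ≤ m - j := by omega
      have h2 : (i : ℝ) + 1 ≤ ((m - j : ℕ) : ℝ) := by exact_mod_cast h1
      linarith
    have hc' : ((m - i : ℕ) : ℝ) / m = 1 - i / m := by
      rw [Nat.cast_sub hi]; field_simp
    have e : binMass m D (m - j) - binHits m D (m - j) - ((m - i : ℕ) : ℝ) / m * binMass m D (m - j)
        = (i : ℝ) / m * binMass m D (m - j) - binHits m D (m - j) := by rw [hc']; ring
    rw [e, integral_outcome_mul_of_isCalibrated hD, hmass, sub_nonpos]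
    refine integral_mono (hc _ _) (hp _) fun z => ?_
    rcases hsupp z.1 (m - j) with h | h
    · simp [h]
    · refine mul_le_mul_of_nonneg_right ?_ (tent_nonneg _)
      rw [div_le_iff₀ hm']; linarith [h.2]
  rw [hU, hL, add_zero]

theorem SCDL_eq_zero_of_isCalibrated {D : Measure Pair} [IsProbabilityMeasure D]
    (hD : IsCalibrated D) : SCDL D = 0 := by
  refine le_antisymm (levelValue_le_of_forall_lt (s := dyadicLoss D) fun k => ?_) (SCDL_nonneg D)
  rw [dyadicLoss, scdlBins_eq_zero_of_isCalibrated hD (by positivity)]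
  positivity

/-! ### Comparison of two distributions -/

/-- A sum of positive parts of means is the mean of the sum over the indices where the mean is
nonnegative; for other distributions, the latter is a lower bound. -/
theorem exists_selection {ι : Type*} (s : Finset ι) {f : ι → Pair → ℝ}
    (hf : ∀ (D : Measure Pair) [IsProbabilityMeasure D] i, Integrable (f i) D) (D : Measure Pair)
    [IsProbabilityMeasure D] : ∃ t ⊆ s,
      ∑ i ∈ s, max (∫ z, f i z ∂D) 0 = ∫ z, ∑ i ∈ t, f i z ∂D ∧
      ∀ (D' : Measure Pair) [IsProbabilityMeasure D'],
        ∫ z, ∑ i ∈ t, f i z ∂D' ≤ ∑ i ∈ s, max (∫ z, f i z ∂D') 0 := by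
  classical
  refine ⟨s.filter fun i => 0 ≤ ∫ z, f i z ∂D, Finset.filter_subset _ _, ?_, fun D' _ => ?_⟩
  · rw [integral_finsetSum _ fun i _ => hf D i, Finset.sum_filter]
    refine Finset.sum_congr rfl fun i _ => ?_
    split_ifs with h
    · exact max_eq_left h
    · exact max_eq_right (not_le.1 h).le
  · rw [integral_finsetSum _ fun i _ => hf D' i]
    calc _ ≤ ∑ i ∈ s.filter fun i => 0 ≤ ∫ z, f i z ∂D, max (∫ z, f i z ∂D') 0 :=
          Finset.sum_le_sum fun i _ => le_max_left _ _
      _ ≤ _ := Finset.sum_le_sum_of_subset_of_nonneg (Finset.filter_subset _ _)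
          fun _ _ _ => le_max_right _ _

theorem abs_sum_binIntegrand_le {h : Bool → ℝ} {c : ℝ} (hc0 : 0 ≤ c) (hc : ∀ y, |h y| ≤ c)
    {n : ℕ} {t : Finset ℕ} (ht : t ⊆ Finset.range n) (y : Bool) (u : ℕ → ℝ) (x : ℝ)
    (hu : ∀ j < n, tent (u j) = tent (x - j)) : |∑ j ∈ t, h y * tent (u j)| ≤ c := by
  calc |∑ j ∈ t, h y * tent (u j)| ≤ ∑ j ∈ t, |h y * tent (u j)| := Finset.abs_sum_le_sum_abs _ _
    _ ≤ ∑ j ∈ t, c * tent (u j) := Finset.sum_le_sum fun j _ => abs_binIntegrand_le hc _ _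
    _ ≤ ∑ j ∈ Finset.range n, c * tent (u j) :=
        Finset.sum_le_sum_of_subset_of_nonneg ht fun j _ _ => mul_nonneg hc0 (tent_nonneg _)
    _ = c * ∑ j ∈ Finset.range n, tent (x - j) := by
        rw [← Finset.mul_sum]
        congr 1
        exact Finset.sum_congr rfl fun j hj => hu j (Finset.mem_range.1 hj)
    _ ≤ c := mul_le_of_le_one_right hc0 (sum_tent_le_one x n)

/-- The loss of `D` is the mean of a bounded function whose mean bounds the loss of every other
distribution from below. -/
theorem exists_test_function {m : ℕ} (hm : 0 < m) (D : Measure Pair) [IsProbabilityMeasure D] :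
    ∃ G : Pair → ℝ, Measurable G ∧ (∀ z, |G z| ≤ 3) ∧ scdlBins m D = ∫ z, G z ∂D ∧
      ∀ (D' : Measure Pair) [IsProbabilityMeasure D'], ∫ z, G z ∂D' ≤ scdlBins m D' := by
  have hm' : (0 : ℝ) < m := by exact_mod_cast hm
  obtain ⟨i, hi, hmax⟩ : ∃ i ∈ Finset.Icc 0 m, scdlBins m D = binLoss m D i :=
    Finset.exists_mem_eq_sup' _ _
  have hi' := (Finset.mem_Icc.1 hi).2
  rw [binLoss_eq hm hi'] at hmax
  set c : ℝ := ((i + 1 : ℕ) : ℝ) / m with hc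
  set c' : ℝ := ((m - i : ℕ) : ℝ) / m with hc'
  have hc0 : 0 ≤ c := by positivity
  have hc2 : c ≤ 2 := by
    rw [hc, div_le_iff₀ hm']
    have : i + 1 ≤ 2 * m := by omega
    exact_mod_cast this
  have hc'0 : 0 ≤ c' := by positivity
  have hc'1 : c' ≤ 1 := by
    rw [hc', div_le_one hm']; exact_mod_cast Nat.sub_le m i
  have hint : ∀ (h : Bool → ℝ) (u : ℕ → ℕ) (D : Measure Pair) [IsProbabilityMeasure D] (j : ℕ),
      Integrable (fun z : Pair => h z.2 * tent (m * z.1 - u j)) D :=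
    fun h u D _ j => integrable_binIntegrand D h m (u j)
  obtain ⟨t, ht, heq, hle⟩ := exists_selection (Finset.range (i + 1))
    (f := fun j z => (outcome z.2 - c) * tent (m * z.1 - j))
    (fun D _ j => hint (fun y => outcome y - c) id D j) D
  obtain ⟨t', ht', heq', hle'⟩ := exists_selection (Finset.range (m - i))
    (f := fun j z => (1 - outcome z.2 - c') * tent (m * z.1 - (m - j : ℕ)))
    (fun D _ j => hint (fun y => 1 - outcome y - c') (fun j => m - j) D j) D
  have hU : ∀ (D : Measure Pair) [IsProbabilityMeasure D], upperExcess m D (i + 1)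
      = ∑ j ∈ Finset.range (i + 1), max (∫ z, (outcome z.2 - c) * tent (m * z.1 - j) ∂D) 0 := by
    intro D _
    unfold upperExcess excess
    refine Finset.sum_congr rfl fun j _ => ?_
    rw [binHits_sub_mul_binMass]; rfl
  have hL : ∀ (D : Measure Pair) [IsProbabilityMeasure D], lowerExcess m D (m - i)
      = ∑ j ∈ Finset.range (m - i),
        max (∫ z, (1 - outcome z.2 - c') * tent (m * z.1 - (m - j : ℕ)) ∂D) 0 := by
    intro D _
    unfold lowerExcess excess
    refine Finset.sum_congr rfl fun j _ => ?_
    rw [binMass_sub_binHits_sub_mul]; rfl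
  have hsum : ∀ (D : Measure Pair) [IsProbabilityMeasure D],
      ∫ z, (∑ j ∈ t, (outcome z.2 - c) * tent (m * z.1 - j)
        + ∑ j ∈ t', (1 - outcome z.2 - c') * tent (m * z.1 - (m - j : ℕ))) ∂D
      = ∫ z, ∑ j ∈ t, (outcome z.2 - c) * tent (m * z.1 - j) ∂D
        + ∫ z, ∑ j ∈ t', (1 - outcome z.2 - c') * tent (m * z.1 - (m - j : ℕ)) ∂D := by
    intro D _
    exact integral_add
      (integrable_finsetSum _ fun j _ => hint (fun y => outcome y - c) id D j)
      (integrable_finsetSum _ fun j _ =>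
        hint (fun y => 1 - outcome y - c') (fun j => m - j) D j)
  refine ⟨fun z => ∑ j ∈ t, (outcome z.2 - c) * tent (m * z.1 - j)
      + ∑ j ∈ t', (1 - outcome z.2 - c') * tent (m * z.1 - (m - j : ℕ)), ?_, ?_, ?_, ?_⟩
  · exact (Finset.measurable_sum t fun j _ =>
      measurable_binIntegrand (fun y => outcome y - c) m (j : ℕ)).add
      (Finset.measurable_sum t' fun j _ =>
        measurable_binIntegrand (fun y => 1 - outcome y - c') m (m - j : ℕ))
  · intro z
    have h1 := abs_sum_binIntegrand_le (h := fun y => outcome y - c) (c := 2) (by norm_num)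
      (fun y => abs_le.2 ⟨by linarith [outcome_nonneg y], by linarith [outcome_le_one y]⟩)
      ht z.2 (fun j => m * z.1 - j) (m * z.1) fun _ _ => rfl
    have h2 := abs_sum_binIntegrand_le (h := fun y => 1 - outcome y - c') (c := 1) (by norm_num)
      (fun y => abs_le.2 ⟨by linarith [outcome_le_one y], by linarith [outcome_nonneg y]⟩)
      ht' z.2 (fun j => m * z.1 - (m - j : ℕ)) (m - m * z.1) fun j hj => by
        rw [Nat.cast_sub (by omega), ← tent_neg]; congr 1; ring
    refine (abs_add_le _ _).trans ?_
    linarith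
  · rw [hmax, hsum, hU, hL, heq, heq']
  · intro D' _
    rw [hsum]
    refine le_trans ?_ (excess_add_le_scdlBins hm D' hi')
    rw [hU, hL]
    exact add_le_add (hle D') (hle' D')

/-- If the bin statistics of `D'` deviate from those of `D` by little more than a standard
deviation, and the loss of `D` is `O(1/m)`, then the loss of `D'` is not much larger. -/
theorem scdlBins_le_of_deviation {m : ℕ} (hm : 0 < m) {D D' : Measure Pair}
    [IsProbabilityMeasure D] [IsProbabilityMeasure D'] {r B : ℝ} (hr : 0 ≤ r)
    (hB : scdlBins m D ≤ B / m)
    (hmass : ∀ j ≤ m, |binMass m D' j - binMass m D j| ≤ r * √(binMass m D j) + r ^ 2)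
    (hhits : ∀ j ≤ m, |binHits m D' j - binHits m D j| ≤ r * √(binMass m D j) + r ^ 2) :
    scdlBins m D' ≤ scdlBins m D + 2 * (3 * r + (3 * r) ^ 2 * (m + 1)
      + (3 * r) ^ 2 * m * harmonic m + 2 * (3 * r) * √B * harmonic m) := by
  have hm' : (0 : ℝ) < m := by exact_mod_cast hm
  rw [scdlBins_le_iff hm]
  intro i hi
  have hdev0 : ∀ j, 0 ≤ r * √(binMass m D j) + r ^ 2 := fun j => by positivity
  have hU : upperExcess m D' (i + 1) ≤ upperExcess m D (i + 1) + (3 * r + (3 * r) ^ 2 * (m + 1)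
      + (3 * r) ^ 2 * m * harmonic m + 2 * (3 * r) * √B * harmonic m) := by
    refine excess_perturb hm (by omega) (binMass_nonneg m D) (binMass_le_one m D) (by positivity)
      (fun j hj => ?_) fun k hk => (upperExcess_le_scdlBins hm D (by omega)).trans hB
    have hc0 : 0 ≤ ((i + 1 : ℕ) : ℝ) / m := by positivity
    have hc2 : ((i + 1 : ℕ) : ℝ) / m ≤ 2 := by
      rw [div_le_iff₀ hm']
      have : i + 1 ≤ 2 * m := by omega
      exact_mod_cast this
    have h1 := (abs_le.1 (hmass j (by omega))).1
    have h2 := (abs_le.1 (hhits j (by omega))).2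
    have h3 : ((i + 1 : ℕ) : ℝ) / m * (binMass m D j - binMass m D' j)
        ≤ 2 * (r * √(binMass m D j) + r ^ 2) :=
      (mul_le_mul_of_nonneg_left (by linarith) hc0).trans
        (mul_le_mul_of_nonneg_right hc2 (hdev0 j))
    linarith [sq_nonneg r]
  have hL : lowerExcess m D' (m - i) ≤ lowerExcess m D (m - i) + (3 * r + (3 * r) ^ 2 * (m + 1)
      + (3 * r) ^ 2 * m * harmonic m + 2 * (3 * r) * √B * harmonic m) := by
    refine excess_perturb hm (by omega) (fun j => binMass_nonneg m D _)
      (fun j => binMass_le_one m D _) (by positivity)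
      (fun j hj => ?_) fun k hk => (lowerExcess_le_scdlBins hm D (by omega)).trans hB
    have hc0 : 0 ≤ ((m - i : ℕ) : ℝ) / m := by positivity
    have hc1 : ((m - i : ℕ) : ℝ) / m ≤ 1 := by
      rw [div_le_one hm']; exact_mod_cast Nat.sub_le m i
    have h1 := (abs_le.1 (hmass (m - j) (by omega))).2
    have h2 := (abs_le.1 (hhits (m - j) (by omega))).1
    have h3 : (1 - ((m - i : ℕ) : ℝ) / m) * (binMass m D' (m - j) - binMass m D (m - j))
        ≤ 1 * (r * √(binMass m D (m - j)) + r ^ 2) :=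
      (mul_le_mul_of_nonneg_left (by linarith) (by linarith)).trans
        (mul_le_mul_of_nonneg_right (by linarith) (hdev0 _))
    have h4 : 0 ≤ r * √(binMass m D (m - j)) := by positivity
    linarith [sq_nonneg r]
  linarith [excess_add_le_scdlBins hm D hi]

/-! ### Concentration of the loss -/

theorem binIntegral_empirical {T : ℕ} (h : Bool → ℝ) (m : ℕ) (x : Fin T → Pair) (j : ℕ) :
    binIntegral h m (empirical x) j
      = sampleMean (fun z : Pair => h z.2 * tent (m * z.1 - j)) x :=
  integral_empirical x (measurable_binIntegrand h m j)

/-- The relative deviation `2 √(L/T)` in Bernstein's inequality. -/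
def devRadius (L : ℝ) (T : ℕ) : ℝ := 2 * √(L / T)

theorem devRadius_nonneg (L : ℝ) (T : ℕ) : 0 ≤ devRadius L T :=
  mul_nonneg zero_le_two (Real.sqrt_nonneg _)

theorem bernstein_devRadius {D : Measure Pair} [IsProbabilityMeasure D] {T : ℕ} (hT : 0 < T)
    {g : Pair → ℝ} (hg : Measurable g) (h0 : ∀ z, 0 ≤ g z) (h1 : ∀ z, g z ≤ 1) {M L : ℝ}
    (hM : ∫ z, g z ∂D ≤ M) (hL : 0 < L) :
    (iidLaw D T).real {x | devRadius L T * √M + devRadius L T ^ 2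
      < |sampleMean g x - ∫ z, g z ∂D|} ≤ 2 * Real.exp (-L) := by
  have hM0 : 0 ≤ M := (integral_nonneg h0).trans hM
  have hLT : 0 ≤ L / T := by positivity
  refine (measureReal_mono fun x hx => ?_).trans (bernstein hT hg h0 h1 hM hL)
  simp only [Set.mem_ofPred_eq] at hx ⊢
  refine le_trans ?_ hx.le
  rw [devRadius, mul_pow, Real.sq_sqrt hLT, Real.sqrt_mul hM0]
  linarith

theorem measureReal_exists_bin_deviation_le {D : Measure Pair} [IsProbabilityMeasure D] {T : ℕ}
    (hT : 0 < T) (m : ℕ) {L : ℝ} (hL : 0 < L) {h : Bool → ℝ} (h0 : ∀ y, 0 ≤ h y)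
    (h1 : ∀ y, h y ≤ 1) :
    (iidLaw D T).real {x | ∃ j ≤ m, devRadius L T * √(binMass m D j) + devRadius L T ^ 2
      < |binIntegral h m (empirical x) j - binIntegral h m D j|}
      ≤ 2 * (m + 1) * Real.exp (-L) := by
  have hsub : {x : Fin T → Pair | ∃ j ≤ m, devRadius L T * √(binMass m D j) + devRadius L T ^ 2
      < |binIntegral h m (empirical x) j - binIntegral h m D j|}
      ⊆ ⋃ j ∈ Finset.range (m + 1), {x | devRadius L T * √(binMass m D j) + devRadius L T ^ 2
        < |sampleMean (fun z : Pair => h z.2 * tent (m * z.1 - j)) x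
          - ∫ z, h z.2 * tent (m * z.1 - j) ∂D|} := by
    rintro x ⟨j, hj, hx⟩
    rw [binIntegral_empirical] at hx
    exact Set.mem_biUnion (Finset.mem_coe.2 (Finset.mem_range.2 (by omega))) hx
  refine (measureReal_mono hsub (measure_ne_top _ _)).trans
    ((measureReal_biUnion_finset_le _ _).trans ?_)
  calc _ ≤ ∑ _j ∈ Finset.range (m + 1), 2 * Real.exp (-L) := by
        refine Finset.sum_le_sum fun j _ => ?_
        refine bernstein_devRadius hT (measurable_binIntegrand h m j)
          (fun z => mul_nonneg (h0 _) (tent_nonneg _))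
          (fun z => mul_le_one₀ (h1 _) (tent_nonneg _) (tent_le_one _)) ?_ hL
        exact binIntegral_mono h1 m D j
    _ = 2 * (m + 1) * Real.exp (-L) := by
        rw [Finset.sum_const, Finset.card_range, nsmul_eq_mul]; push_cast; ring

/-- The error bound for the loss with `m` bins, for a relative deviation `r` of the bin statistics
and a loss of at most `B/m`; see `scdlBins_le_of_deviation`. -/
def lossError (r B : ℝ) (m : ℕ) : ℝ :=
  2 * (3 * r + (3 * r) ^ 2 * (m + 1) + (3 * r) ^ 2 * m * harmonic m
    + 2 * (3 * r) * √B * harmonic m)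

theorem lossError_nonneg {r : ℝ} (hr : 0 ≤ r) (B : ℝ) (m : ℕ) : 0 ≤ lossError r B m := by
  have hH : (0 : ℝ) ≤ harmonic m := by simpa using harmonic_mono_real (Nat.zero_le m)
  unfold lossError; positivity

theorem lossError_mono {r : ℝ} (hr : 0 ≤ r) (B : ℝ) {m n : ℕ} (h : m ≤ n) :
    lossError r B m ≤ lossError r B n := by
  have hH : (0 : ℝ) ≤ harmonic m := by simpa using harmonic_mono_real (Nat.zero_le m)
  have hH' := harmonic_mono_real h
  have h' : (m : ℝ) ≤ n := by exact_mod_cast h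
  unfold lossError
  gcongr

/-- Upper deviations: a suitable number of bins for `D` also does for the sample. -/
theorem measureReal_upper_deviation_le {D : Measure Pair} [IsProbabilityMeasure D] {T : ℕ}
    (hT : 0 < T) {L : ℝ} (hL : 0 < L) {B : ℝ} {K : ℕ}
    (hK : ∃ k ≤ K, max (dyadicLoss D k) (1 / (2 : ℝ) ^ (k + 1)) ≤ SCDL D + 1 / (2 : ℝ) ^ (K + 1) ∧
      dyadicLoss D k ≤ B / (2 : ℝ) ^ (k + 1)) :
    (iidLaw D T).real {x | SCDL D + 1 / (2 : ℝ) ^ (K + 1)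
        + lossError (devRadius L T) B (2 ^ (K + 1)) < SCDL (empirical x)}
      ≤ 4 * ((2 : ℝ) ^ (K + 1) + 1) * Real.exp (-L) := by
  obtain ⟨k, hkK, hval, hB⟩ := hK
  have hr := devRadius_nonneg L T
  set r := devRadius L T with hrdef
  set m := 2 ^ (k + 1) with hm
  have hm0 : 0 < m := by positivity
  have hmM : m ≤ 2 ^ (K + 1) := Nat.pow_le_pow_right (by norm_num) (by omega)
  have hsub : {x : Fin T → Pair | SCDL D + 1 / (2 : ℝ) ^ (K + 1) + lossError r B (2 ^ (K + 1))
        < SCDL (empirical x)}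
      ⊆ {x | ∃ j ≤ m, r * √(binMass m D j) + r ^ 2
          < |binIntegral (fun _ => 1) m (empirical x) j - binIntegral (fun _ => 1) m D j|}
        ∪ {x | ∃ j ≤ m, r * √(binMass m D j) + r ^ 2
          < |binIntegral outcome m (empirical x) j - binIntegral outcome m D j|} := by
    intro x hx
    by_contra hcon
    simp only [Set.mem_union, Set.mem_ofPred_eq, not_or, not_exists, not_and, not_lt] at hcon
    have := isProbabilityMeasure_empirical hT x
    have h1 : scdlBins m (empirical x) ≤ scdlBins m D + lossError r B m :=
      scdlBins_le_of_deviation hm0 hr (by rw [hm]; push_cast; exact hB) hcon.1 hcon.2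
    have h2 : SCDL (empirical x) ≤ max (scdlBins m (empirical x)) (1 / (2 : ℝ) ^ (k + 1)) :=
      levelValue_le (dyadicLoss (empirical x)) k
    have h3 := lossError_mono hr B hmM
    have h4 := lossError_nonneg hr B m
    have h5 : dyadicLoss D k = scdlBins m D := rfl
    rw [h5] at hval
    have h6 := (le_max_left _ _).trans hval
    have h7 := (le_max_right _ _).trans hval
    have h8 : SCDL (empirical x) ≤ SCDL D + 1 / (2 : ℝ) ^ (K + 1) + lossError r B (2 ^ (K + 1)) :=
      h2.trans (max_le (by linarith) (by linarith))
    exact absurd hx (not_lt.2 h8)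
  have hb1 := measureReal_exists_bin_deviation_le (D := D) hT m hL (h := fun _ => 1)
    (fun _ => zero_le_one) (fun _ => le_rfl)
  have hb2 := measureReal_exists_bin_deviation_le (D := D) hT m hL outcome_nonneg outcome_le_one
  have hmM' : (m : ℝ) ≤ (2 : ℝ) ^ (K + 1) := by exact_mod_cast hmM
  have hexp := Real.exp_pos (-L)
  calc _ ≤ _ := measureReal_mono hsub
    _ ≤ _ := measureReal_union_le _ _
    _ ≤ 4 * ((m : ℝ) + 1) * Real.exp (-L) := by linarith
    _ ≤ _ := by gcongr

/-- Lower deviations, from the concentration of a single mean. -/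
theorem measureReal_lower_deviation_le {D : Measure Pair} [IsProbabilityMeasure D] {T : ℕ}
    (hT : 0 < T) {L : ℝ} (hL : 0 < L) :
    (iidLaw D T).real {x | SCDL (empirical x)
      < SCDL D - 6 * (devRadius L T + devRadius L T ^ 2)} ≤ 2 * Real.exp (-L) := by
  have hr := devRadius_nonneg L T
  obtain ⟨k, hk⟩ := exists_index_lower (s := dyadicLoss D)
  obtain ⟨G, hGm, hG3, hGD, hGle⟩ := exists_test_function (m := 2 ^ (k + 1)) (by positivity) D
  have hGint : ∀ (D : Measure Pair) [IsProbabilityMeasure D], Integrable G D := fun D _ =>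
    integrable_of_measurable_of_abs_le hGm hG3
  have hgint : ∀ (D : Measure Pair) [IsProbabilityMeasure D],
      ∫ z, (G z + 3) / 6 ∂D = (∫ z, G z ∂D + 3) / 6 := by
    intro D _
    rw [integral_div, integral_add (hGint D) (integrable_const _)]; simp
  have hgm : Measurable fun z => (G z + 3) / 6 := (hGm.add_const 3).div_const 6
  have hg0 : ∀ z, 0 ≤ (G z + 3) / 6 := fun z => by linarith [(abs_le.1 (hG3 z)).1]
  have hg1 : ∀ z, (G z + 3) / 6 ≤ 1 := fun z => by linarith [(abs_le.1 (hG3 z)).2]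
  have hM : ∫ z, (G z + 3) / 6 ∂D ≤ 1 := by
    have h1 : Integrable (fun z => (G z + 3) / 6) D :=
      integrable_of_measurable_of_abs_le hgm (c := 1) fun z => by
        rw [abs_of_nonneg (hg0 z)]; exact hg1 z
    simpa using integral_mono h1 (integrable_const (1 : ℝ)) hg1
  -- `(G + 3) / 6` takes values in `[0, 1]`
  refine (measureReal_mono fun x hx => ?_).trans (bernstein_devRadius hT hgm hg0 hg1 hM hL)
  have := isProbabilityMeasure_empirical hT x
  simp only [Set.mem_ofPred_eq] at hx ⊢
  rw [Real.sqrt_one, mul_one, ← integral_empirical x hgm, hgint, hgint]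
  by_contra hcon
  have h1 := (abs_le.1 (not_lt.1 hcon)).1
  have h2 := hGle (empirical x)
  have h3 := hk (dyadicLoss (empirical x)) (monotone_dyadicLoss _)
    (6 * (devRadius L T + devRadius L T ^ 2)) (by positivity) (by
      unfold dyadicLoss; rw [hGD]; linarith)
  rw [← SCDL_eq_levelValue, ← SCDL_eq_levelValue] at h3
  linarith

/-! ### Choice of the number of bins -/

theorem exists_two_pow_between {σ : ℝ} (h0 : 0 < σ) (h1 : σ ≤ 1) :
    ∃ K : ℕ, 1 / (2 : ℝ) ^ (K + 1) ≤ σ ∧ (2 : ℝ) ^ (K + 1) ≤ 2 / σ := by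
  classical
  have hex : ∃ K : ℕ, 1 / (2 : ℝ) ^ (K + 1) ≤ σ := by
    obtain ⟨K, hK⟩ := exists_pow_lt_of_lt_one h0 (by norm_num : (1 / 2 : ℝ) < 1)
    refine ⟨K, (one_div_two_pow_anti (Nat.le_succ K)).trans ?_⟩
    rw [← one_div_pow]; exact hK.le
  refine ⟨Nat.find hex, Nat.find_spec hex, ?_⟩
  rcases Nat.eq_zero_or_pos (Nat.find hex) with h | h
  · rw [h, zero_add, pow_one, le_div_iff₀ h0]; linarith
  · obtain ⟨n, hn⟩ : ∃ n, Nat.find hex = n + 1 := ⟨Nat.find hex - 1, by omega⟩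
    have h2 := not_le.1 (Nat.find_min hex (by omega : n < Nat.find hex))
    rw [lt_div_iff₀ (by positivity)] at h2
    rw [hn, pow_succ, le_div_iff₀ h0]
    linarith

theorem harmonic_two_pow_le {σ : ℝ} {K : ℕ} (hK : (2 : ℝ) ^ (K + 1) ≤ 2 / σ) :
    (harmonic (2 ^ (K + 1)) : ℝ) ≤ 1 + Real.log (2 / σ) := by
  have h := harmonic_le_one_add_log (2 ^ (K + 1))
  push_cast at h
  exact h.trans (by gcongr)

/-- With `L' = 9 L`, a union bound over the `O(T)` events of probability `e^{-L'}` leaves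
probability `e^{-L}`. -/
theorem union_bound_le {T : ℕ} (hT : 2 ≤ T) {L M : ℝ} (hL : Real.log T ≤ L)
    (hM : M ≤ 8 * T) :
    4 * (M + 1) * Real.exp (-(9 * L)) + 2 * Real.exp (-(9 * L)) ≤ Real.exp (-L) := by
  have hT' : (2 : ℝ) ≤ T := by exact_mod_cast hT
  have h1 : Real.exp (-(9 * L)) = Real.exp (-L) * Real.exp (-L) ^ 8 := by
    rw [← Real.exp_nat_mul, ← Real.exp_add]; congr 1; push_cast; ring
  have h2 : Real.exp (-L) ≤ (T : ℝ)⁻¹ := by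
    rw [← Real.exp_log (by positivity : (0 : ℝ) < (T : ℝ)), ← Real.exp_neg]
    exact Real.exp_le_exp.2 (by linarith)
  have h3 : Real.exp (-L) ^ 8 ≤ ((T : ℝ)⁻¹) ^ 8 := by gcongr
  have h4 : (2 : ℝ) ^ 7 ≤ (T : ℝ) ^ 7 := by gcongr
  have h5 : (4 * (M + 1) + 2) * Real.exp (-L) ^ 8 ≤ 1 := by
    calc (4 * (M + 1) + 2) * Real.exp (-L) ^ 8 ≤ (T : ℝ) ^ 8 * ((T : ℝ)⁻¹) ^ 8 := by
          refine mul_le_mul ?_ h3 (by positivity) (by positivity)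
          have : (2 : ℝ) ^ 7 * T ≤ (T : ℝ) ^ 7 * T := by gcongr
          have h6 : (T : ℝ) ^ 8 = T ^ 7 * T := by ring
          linarith
      _ = 1 := by rw [← mul_pow, mul_inv_cancel₀ (by positivity), one_pow]
  rw [h1]
  have := Real.exp_pos (-L)
  nlinarith

theorem one_sub_le_measureReal_of_compl_subset {Ω : Type*} [MeasurableSpace Ω] {μ : Measure Ω}
    [IsProbabilityMeasure μ] {A B : Set Ω} (h : Aᶜ ⊆ B) {p : ℝ} (hB : μ.real B ≤ p) :
    1 - p ≤ μ.real A := by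
  have h1 : (1 : ℝ) ≤ μ.real A + μ.real B := by
    calc (1 : ℝ) = μ.real (A ∪ Aᶜ) := by rw [Set.union_compl_self, probReal_univ]
      _ ≤ μ.real A + μ.real Aᶜ := measureReal_union_le _ _
      _ ≤ _ := by linarith [measureReal_mono h (measure_ne_top μ B)]
  linarith

section Rates

variable {T : ℕ} {L : ℝ}

theorem log_two_le_log_div (hL0 : 0 < L) (hL2 : L ≤ T / 2) :
    Real.log 2 ≤ Real.log (T / L) := by
  refine Real.log_le_log (by norm_num) ?_
  rw [le_div_iff₀ hL0]; linarith

theorem devRadius_nine_mul (L : ℝ) (T : ℕ) : devRadius (9 * L) T = 6 * √(L / T) := by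
  rw [devRadius, mul_div_assoc, Real.sqrt_mul (by norm_num), show (9 : ℝ) = 3 ^ 2 by norm_num,
    Real.sqrt_sq (by norm_num)]
  ring

theorem log_inv_sqrt_div (hL0 : 0 < L) (hT : 0 < T) :
    -Real.log (√(L / T)) = Real.log (T / L) / 2 := by
  have hT' : (0 : ℝ) < T := by exact_mod_cast hT
  rw [Real.log_sqrt (by positivity), Real.log_div hL0.ne' hT'.ne', Real.log_div hT'.ne' hL0.ne']
  ring

theorem one_div_two_mul_le_sqrt (hT : 2 ≤ T) (hL : Real.log T ≤ L) :
    1 / (2 * (T : ℝ)) ≤ √(L / T) := by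
  have hT' : (2 : ℝ) ≤ T := by exact_mod_cast hT
  have h1 : Real.log 2 ≤ Real.log T := Real.log_le_log (by norm_num) hT'
  have h2 := Real.log_two_gt_d9
  refine Real.le_sqrt_of_sq_le ?_
  rw [div_pow, one_pow, div_le_div_iff₀ (by positivity) (by positivity)]
  nlinarith

/-- The high-probability bound for arbitrary distributions. -/
theorem concentration {D : Measure Pair} [IsProbabilityMeasure D] (hT : 2 ≤ T)
    (hL : Real.log T ≤ L) (hL2 : L ≤ T / 2) :
    1 - Real.exp (-L) ≤ (iidLaw D T).real {x | |SCDL (empirical x) - SCDL D|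
      ≤ 10000 * (√(L / T) * Real.log (T / L))} := by
  have hT' : (2 : ℝ) ≤ T := by exact_mod_cast hT
  have hl2 := Real.log_two_gt_d9
  have hlT : Real.log 2 ≤ Real.log T := Real.log_le_log (by norm_num) hT'
  have hL0 : 0 < L := by linarith
  have hΛ := log_two_le_log_div hL0 hL2
  have hlog := log_inv_sqrt_div (T := T) hL0 (by omega)
  have hρT := one_div_two_mul_le_sqrt hT hL
  have hrad := devRadius_nine_mul L T
  set Λ := Real.log (T / L) with hΛdef
  set ρ := √(L / T) with hρ
  have hρ0 : 0 < ρ := Real.sqrt_pos.2 (by positivity)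
  have hρ1 : ρ ≤ 1 := Real.sqrt_le_one.2 (by rw [div_le_one (by positivity)]; linarith)
  obtain ⟨K, hK1, hK2⟩ := exists_two_pow_between hρ0 hρ1
  have hH := harmonic_two_pow_le hK2
  rw [Real.log_div (by norm_num) hρ0.ne'] at hH
  have hH' : (harmonic (2 ^ (K + 1)) : ℝ) ≤ 3 * Λ := by linarith
  have hH0 : (0 : ℝ) ≤ harmonic (2 ^ (K + 1)) := by simpa using harmonic_mono_real (Nat.zero_le _)
  have hup := measureReal_upper_deviation_le (D := D) (T := T) (by omega)
    (by positivity : 0 < 9 * L) (exists_index_upper (monotone_dyadicLoss D)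
      (dyadicLoss_zero_le D) K)
  have hlo := measureReal_lower_deviation_le (D := D) (T := T) (by omega)
    (by positivity : 0 < 9 * L)
  rw [hrad] at hup hlo
  have hM8 : (2 : ℝ) ^ (K + 1) ≤ 8 * T := by
    refine hK2.trans ?_
    rw [div_le_iff₀ hρ0]
    rw [div_le_iff₀ (by positivity)] at hρT
    linarith
  have hMρ : (2 : ℝ) ^ (K + 1) * ρ ≤ 2 := by rwa [le_div_iff₀ hρ0] at hK2
  have hρΛ : ρ ≤ 3 / 2 * (ρ * Λ) := by nlinarith
  have hs6 : √(6 : ℝ) ≤ 5 / 2 := Real.sqrt_le_iff.2 ⟨by norm_num, by norm_num⟩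
  have herr : 1 / (2 : ℝ) ^ (K + 1) + lossError (6 * ρ) 6 (2 ^ (K + 1)) ≤ 10000 * (ρ * Λ) := by
    unfold lossError
    push_cast
    have e1 : (3 * (6 * ρ)) ^ 2 * ((2 : ℝ) ^ (K + 1) + 1) ≤ 972 * ρ := by
      have : ρ * ((2 : ℝ) ^ (K + 1) + 1) ≤ 3 := by linarith
      nlinarith
    have e2 : (3 * (6 * ρ)) ^ 2 * (2 : ℝ) ^ (K + 1) * harmonic (2 ^ (K + 1))
        ≤ 648 * ρ * (3 * Λ) := by
      refine mul_le_mul ?_ hH' hH0 (by positivity)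
      nlinarith
    have e3 : 2 * (3 * (6 * ρ)) * √6 * harmonic (2 ^ (K + 1)) ≤ 90 * ρ * (3 * Λ) := by
      refine mul_le_mul ?_ hH' hH0 (by positivity)
      nlinarith
    linarith
  have hlow : 6 * (6 * ρ + (6 * ρ) ^ 2) ≤ 10000 * (ρ * Λ) := by nlinarith
  refine one_sub_le_measureReal_of_compl_subset (B :=
    {x | SCDL D + 1 / (2 : ℝ) ^ (K + 1) + lossError (6 * ρ) 6 (2 ^ (K + 1)) < SCDL (empirical x)}
      ∪ {x | SCDL (empirical x) < SCDL D - 6 * (6 * ρ + (6 * ρ) ^ 2)}) ?_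
    ((measureReal_union_le _ _).trans ((add_le_add hup hlo).trans (union_bound_le hT hL hM8)))
  intro x hx
  rw [Set.mem_compl_iff, Set.mem_ofPred_eq, abs_le, not_and_or, not_le, not_le] at hx
  rcases hx with h | h
  · right; simp only [Set.mem_ofPred_eq]; linarith
  · left; simp only [Set.mem_ofPred_eq]; linarith

/-- The improved bound: when `SCDL D = 0`, the bins near the threshold carry no mass, and a
smaller number of bins is optimal. -/
theorem concentration_of_SCDL_eq_zero {D : Measure Pair} [IsProbabilityMeasure D] (hT : 2 ≤ T)
    (hL : Real.log T ≤ L) (hL2 : L ≤ T / 2) (hD : SCDL D = 0) :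
    1 - Real.exp (-L) ≤ (iidLaw D T).real {x | SCDL (empirical x)
      ≤ 10000 * √(L / T * Real.log (T / L))} := by
  have hT' : (2 : ℝ) ≤ T := by exact_mod_cast hT
  have hl2 := Real.log_two_gt_d9
  have hl2' := Real.log_two_lt_d9
  have hlT : Real.log 2 ≤ Real.log T := Real.log_le_log (by norm_num) hT'
  have hL0 : 0 < L := by linarith
  have hΛ := log_two_le_log_div hL0 hL2
  have hlog := log_inv_sqrt_div (T := T) hL0 (by omega)
  have hρT := one_div_two_mul_le_sqrt hT hL
  have hrad := devRadius_nine_mul L T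
  have hσ1' : L / T * Real.log (T / L) ≤ 1 := by
    have h1 := Real.log_le_sub_one_of_pos (by positivity : 0 < (T : ℝ) / L)
    have h2 : L / T * (T / L) = 1 := by field_simp
    have h3 : 0 < L / T := by positivity
    nlinarith
  rw [Real.sqrt_mul (by positivity)]
  have hσ1 : √(L / T) * √(Real.log (T / L)) ≤ 1 := by
    rw [← Real.sqrt_mul (by positivity)]; exact Real.sqrt_le_one.2 hσ1'
  set Λ := Real.log (T / L) with hΛdef
  set ρ := √(L / T) with hρ
  have hρ0 : 0 < ρ := Real.sqrt_pos.2 (by positivity)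
  have hΛ0 : 0 < Λ := by linarith
  have hsΛ : 4 / 5 ≤ √Λ := Real.le_sqrt_of_sq_le (by norm_num; linarith)
  have hsΛsq : √Λ * √Λ = Λ := Real.mul_self_sqrt hΛ0.le
  have hσ0 : 0 < ρ * √Λ := mul_pos hρ0 (by linarith)
  obtain ⟨K, hK1, hK2⟩ := exists_two_pow_between hσ0 hσ1
  have hH := harmonic_two_pow_le hK2
  have hσρ : ρ / 2 ≤ ρ * √Λ := by nlinarith
  have hH' : (harmonic (2 ^ (K + 1)) : ℝ) ≤ 4 * Λ := by
    have h1 : Real.log (2 / (ρ * √Λ)) ≤ Real.log (4 / ρ) := by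
      refine Real.log_le_log (by positivity) ?_
      rw [div_le_div_iff₀ hσ0 hρ0]; linarith
    have h2 : Real.log 4 = 2 * Real.log 2 := by
      rw [show (4 : ℝ) = 2 ^ 2 by norm_num, Real.log_pow]; push_cast; ring
    rw [Real.log_div (by norm_num) hρ0.ne', h2] at h1
    linarith
  have hH0 : (0 : ℝ) ≤ harmonic (2 ^ (K + 1)) := by simpa using harmonic_mono_real (Nat.zero_le _)
  have hzero := eq_zero_of_levelValue_eq_zero (monotone_dyadicLoss D) (dyadicLoss_nonneg D) hD
  have hup := measureReal_upper_deviation_le (D := D) (T := T) (by omega)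
    (by positivity : 0 < 9 * L) (B := 0) (K := K) ⟨K, le_rfl, by
      rw [hzero K, hD, zero_add]; exact max_le (by positivity) le_rfl, by
      rw [hzero K]; simp⟩
  rw [hrad, hD, zero_add] at hup
  have hM8 : (2 : ℝ) ^ (K + 1) ≤ 8 * T := by
    refine hK2.trans ?_
    rw [div_le_iff₀ hσ0]
    rw [div_le_iff₀ (by positivity)] at hρT
    nlinarith
  have hMσ : (2 : ℝ) ^ (K + 1) * (ρ * √Λ) ≤ 2 := by rwa [le_div_iff₀ hσ0] at hK2
  have hρσ : ρ ≤ 5 / 4 * (ρ * √Λ) := by nlinarith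
  have herr : 1 / (2 : ℝ) ^ (K + 1) + lossError (6 * ρ) 0 (2 ^ (K + 1))
      ≤ 10000 * (ρ * √Λ) := by
    unfold lossError
    push_cast
    rw [Real.sqrt_zero, mul_zero, zero_mul, add_zero]
    have e0 : ρ * ρ * (2 : ℝ) ^ (K + 1) * Λ ≤ 2 * (ρ * √Λ) := by
      have : ρ * ρ * (2 : ℝ) ^ (K + 1) * Λ = (2 : ℝ) ^ (K + 1) * (ρ * √Λ) * (ρ * √Λ) := by
        linear_combination (-(ρ * ρ * (2 : ℝ) ^ (K + 1))) * hsΛsq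
      rw [this]
      exact mul_le_mul_of_nonneg_right hMσ hσ0.le
    have e2 : (3 * (6 * ρ)) ^ 2 * (2 : ℝ) ^ (K + 1) * harmonic (2 ^ (K + 1))
        ≤ 2592 * (ρ * √Λ) := by
      calc _ ≤ (3 * (6 * ρ)) ^ 2 * (2 : ℝ) ^ (K + 1) * (4 * Λ) := by gcongr
        _ = 1296 * (ρ * ρ * (2 : ℝ) ^ (K + 1) * Λ) := by ring
        _ ≤ _ := by linarith
    have e1 : (3 * (6 * ρ)) ^ 2 * ((2 : ℝ) ^ (K + 1) + 1) ≤ 1458 * (ρ * √Λ) := by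
      have hM1 : (2 : ℝ) ≤ (2 : ℝ) ^ (K + 1) := by
        rw [pow_succ]; linarith [one_le_pow₀ (one_le_two : (1 : ℝ) ≤ 2) (n := K)]
      have h1 : 0 ≤ ρ * ρ * (2 : ℝ) ^ (K + 1) := by positivity
      have h2 : ρ * ρ * (2 : ℝ) ^ (K + 1) ≤ 3 / 2 * (ρ * ρ * (2 : ℝ) ^ (K + 1) * Λ) := by
        nlinarith
      have h3 : ρ * ρ * 2 ≤ ρ * ρ * (2 : ℝ) ^ (K + 1) := by gcongr
      linarith
    linarith
  refine one_sub_le_measureReal_of_compl_subset (B := {x | 1 / (2 : ℝ) ^ (K + 1)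
    + lossError (6 * ρ) 0 (2 ^ (K + 1)) < SCDL (empirical x)}) ?_
    (hup.trans (le_trans (le_add_of_nonneg_right (by positivity)) (union_bound_le hT hL hM8)))
  intro x hx
  rw [Set.mem_compl_iff, Set.mem_ofPred_eq, not_le] at hx
  exact lt_of_le_of_lt herr hx

end Rates

/-! ### Bounds in expectation -/

theorem measurable_SCDL_empirical {T : ℕ} (hT : 0 < T) :
    Measurable fun x : Fin T → Pair => SCDL (empirical x) := by
  have hbin : ∀ (h : Bool → ℝ) (m j : ℕ),
      Measurable fun x : Fin T → Pair => binIntegral h m (empirical x) j := by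
    intro h m j
    simp_rw [binIntegral_empirical]
    exact measurable_sampleMean (measurable_binIntegrand h m j)
  have hloss : ∀ (m : ℕ), 0 < m → Measurable fun x : Fin T → Pair => scdlBins m (empirical x) := by
    intro m hm
    have hne : (Finset.Icc 0 m).Nonempty := ⟨0, Finset.mem_Icc.2 ⟨le_rfl, Nat.zero_le m⟩⟩
    have : (fun x : Fin T → Pair => scdlBins m (empirical x))
        = (Finset.Icc 0 m).sup' hne
          fun i x => binLoss m (empirical x) i := by
      funext x; rw [Finset.sup'_apply]; rfl
    rw [this]
    refine Finset.measurable_sup' _ fun i hi => ?_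
    have heq : (fun x : Fin T → Pair => binLoss m (empirical x) i)
        = fun x => upperExcess m (empirical x) (i + 1) + lowerExcess m (empirical x) (m - i) := by
      funext x
      have := isProbabilityMeasure_empirical hT x
      exact binLoss_eq hm (Finset.mem_Icc.1 hi).2 _
    rw [heq]
    unfold upperExcess lowerExcess excess
    refine Measurable.add ?_ ?_
    · exact Finset.measurable_sum _ fun j _ =>
        ((hbin _ _ _).sub ((hbin _ _ _).const_mul _)).max measurable_const
    · exact Finset.measurable_sum _ fun j _ =>
        (((hbin _ _ _).sub (hbin _ _ _)).sub ((hbin _ _ _).const_mul _)).max measurable_const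
  unfold SCDL
  exact Measurable.iInf fun k => (hloss _ (by positivity)).max measurable_const

theorem integrable_SCDL_empirical (D : Measure Pair) [IsProbabilityMeasure D] {T : ℕ}
    (hT : 0 < T) : Integrable (fun x => SCDL (empirical x)) (iidLaw D T) := by
  refine Integrable.of_bound (measurable_SCDL_empirical hT).aestronglyMeasurable 3
    (Filter.Eventually.of_forall fun x => ?_)
  have := isProbabilityMeasure_empirical hT x
  rw [Real.norm_eq_abs, abs_of_nonneg (SCDL_nonneg _)]
  exact SCDL_le_three _

theorem integral_le_of_tail_le {Ω : Type*} [MeasurableSpace Ω] {μ : Measure Ω}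
    [IsProbabilityMeasure μ] {f : Ω → ℝ} (hf : Measurable f) {c ε p : ℝ} (hfi : Integrable f μ)
    (hc0 : 0 ≤ c) (hε : 0 ≤ ε) (hc : ∀ x, f x ≤ c) (h : 1 - p ≤ μ.real {x | f x ≤ ε}) :
    ∫ x, f x ∂μ ≤ ε + c * p := by
  have hms : MeasurableSet {x | f x ≤ ε} := measurableSet_le hf measurable_const
  have hcompl : μ.real {x | f x ≤ ε}ᶜ ≤ p := by
    rw [probReal_compl_eq_one_sub hms]; linarith
  have hind : Integrable ({x | f x ≤ ε}ᶜ.indicator fun _ => c) μ :=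
    (integrable_const c).indicator hms.compl
  calc ∫ x, f x ∂μ ≤ ∫ x, (ε + {x | f x ≤ ε}ᶜ.indicator (fun _ => c) x) ∂μ := by
        refine integral_mono hfi ((integrable_const ε).add hind) fun x => ?_
        by_cases hx : f x ≤ ε
        · simp [Set.indicator, hx]
        · simp only [Set.indicator, Set.mem_compl_iff, Set.mem_ofPred_eq, hx, not_false_eq_true,
            if_true]
          linarith [hc x]
    _ = ε + μ.real {x | f x ≤ ε}ᶜ * c := by
        rw [integral_add (integrable_const ε) hind, integral_indicator_const _ hms.compl]
        simp
    _ ≤ ε + c * p := by nlinarith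

theorem log_le_half {T : ℕ} (hT : 2 ≤ T) : Real.log T ≤ T / 2 := by
  have hT' : (2 : ℝ) ≤ T := by exact_mod_cast hT
  have h1 := Real.log_le_sub_one_of_pos (by positivity : (0 : ℝ) < T / 2)
  rw [Real.log_div (by positivity) (by norm_num)] at h1
  linarith [Real.log_two_lt_d9]

theorem log_div_log_le {T : ℕ} (hT : 2 ≤ T) : Real.log (T / Real.log T) ≤ 2 * Real.log T := by
  have hT' : (2 : ℝ) ≤ T := by exact_mod_cast hT
  have h1 : Real.log 2 ≤ Real.log T := Real.log_le_log (by norm_num) hT'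
  have h2 := Real.log_two_gt_d9
  have h3 : 0 < Real.log T := by linarith
  rw [show 2 * Real.log T = Real.log ((T : ℝ) ^ 2) by rw [Real.log_pow]; norm_num]
  refine Real.log_le_log (by positivity) ?_
  rw [div_le_iff₀ h3]
  nlinarith [mul_le_mul hT' h1 (by linarith) (by linarith)]

theorem sqrt_log_div_eq (T : ℕ) :
    √(Real.log T / T) = (T : ℝ) ^ (-(1 / 2) : ℝ) * √(Real.log T) := by
  rw [Real.sqrt_div' _ (Nat.cast_nonneg T), Real.rpow_neg (Nat.cast_nonneg T),
    ← Real.sqrt_eq_rpow, div_eq_inv_mul]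

theorem inv_le_rpow_neg_half {T : ℕ} (hT : 2 ≤ T) : (T : ℝ)⁻¹ ≤ (T : ℝ) ^ (-(1 / 2) : ℝ) := by
  have hT' : (1 : ℝ) ≤ T := by exact_mod_cast (by omega : 1 ≤ T)
  rw [← Real.rpow_neg_one]
  exact Real.rpow_le_rpow_of_exponent_le hT' (by norm_num)

theorem exp_neg_log_natCast {T : ℕ} (hT : 2 ≤ T) : Real.exp (-Real.log T) = (T : ℝ)⁻¹ := by
  rw [Real.exp_neg, Real.exp_log (by exact_mod_cast (by omega : 0 < T))]

theorem log_natCast_ge {T : ℕ} (hT : 2 ≤ T) : (16 : ℝ) / 25 ≤ Real.log T := by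
  have hT' : (2 : ℝ) ≤ T := by exact_mod_cast hT
  have h1 : Real.log 2 ≤ Real.log T := Real.log_le_log (by norm_num) hT'
  linarith [Real.log_two_gt_d9]

theorem integral_abs_SCDL_sub_le (D : Measure Pair) [IsProbabilityMeasure D] {T : ℕ}
    (hT : 2 ≤ T) : ∫ x, |SCDL (empirical x) - SCDL D| ∂(iidLaw D T)
      ≤ 30000 * ((T : ℝ) ^ (-(1 / 2) : ℝ) * Real.log T ^ (3 / 2 : ℝ)) := by
  have hlog := log_natCast_ge hT
  have hl0 : 0 ≤ Real.log T := by linarith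
  have hΛ := log_div_log_le hT
  have hmeas := measurable_SCDL_empirical (T := T) (by omega)
  have hint := integrable_SCDL_empirical D (T := T) (by omega)
  have hΛ0 : 0 ≤ Real.log (T / Real.log T) :=
    (Real.log_nonneg one_le_two).trans (log_two_le_log_div (by linarith) (log_le_half hT))
  have h := integral_le_of_tail_le (μ := iidLaw D T) (c := 3)
    ((hmeas.sub_const (SCDL D)).abs) (hint.sub (integrable_const _)).abs (by norm_num)
    (by positivity) (fun x => by
      have := isProbabilityMeasure_empirical (by omega : 0 < T) x
      rw [abs_le]
      constructor <;>
        linarith [SCDL_nonneg D, SCDL_le_three D, SCDL_nonneg (empirical x),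
          SCDL_le_three (empirical x)])
    (concentration (D := D) hT le_rfl (log_le_half hT))
  refine h.trans ?_
  have hs : 4 / 5 ≤ √(Real.log T) := Real.le_sqrt_of_sq_le (by norm_num; linarith)
  have hpow : Real.log T ^ (3 / 2 : ℝ) = Real.log T * √(Real.log T) := by
    rw [show (3 / 2 : ℝ) = 1 + 1 / 2 by norm_num, Real.rpow_add (by linarith), Real.rpow_one,
      ← Real.sqrt_eq_rpow]
  rw [exp_neg_log_natCast hT, sqrt_log_div_eq, hpow]
  set τ := (T : ℝ) ^ (-(1 / 2) : ℝ) with hτ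
  have hτ0 : 0 ≤ τ := by positivity
  have h1 := inv_le_rpow_neg_half hT
  have h2 : 1 ≤ 2 * (Real.log T * √(Real.log T)) := by nlinarith
  have h3 : τ * √(Real.log T) * Real.log (T / Real.log T)
      ≤ τ * √(Real.log T) * (2 * Real.log T) := by gcongr
  have h4 : τ * 1 ≤ τ * (2 * (Real.log T * √(Real.log T))) := by gcongr
  nlinarith

theorem integral_SCDL_le_of_SCDL_eq_zero {D : Measure Pair} [IsProbabilityMeasure D] {T : ℕ}
    (hT : 2 ≤ T) (hD : SCDL D = 0) : ∫ x, SCDL (empirical x) ∂(iidLaw D T)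
      ≤ 30000 * ((T : ℝ) ^ (-(1 / 2) : ℝ) * Real.log T) := by
  have hlog := log_natCast_ge hT
  have hl0 : 0 ≤ Real.log T := by linarith
  have hΛ := log_div_log_le hT
  have h := integral_le_of_tail_le (μ := iidLaw D T) (c := 3)
    (measurable_SCDL_empirical (T := T) (by omega)) (integrable_SCDL_empirical D (by omega))
    (by norm_num) (by positivity) (fun x => by
      have := isProbabilityMeasure_empirical (by omega : 0 < T) x
      exact SCDL_le_three (empirical x))
    (concentration_of_SCDL_eq_zero (D := D) hT le_rfl (log_le_half hT) hD)
  refine h.trans ?_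
  rw [exp_neg_log_natCast hT, Real.sqrt_mul (by positivity), sqrt_log_div_eq]
  set τ := (T : ℝ) ^ (-(1 / 2) : ℝ) with hτ
  have hτ0 : 0 ≤ τ := by positivity
  have h1 := inv_le_rpow_neg_half hT
  have h2 : √(Real.log (T / Real.log T)) ≤ 2 * √(Real.log T) := by
    refine Real.sqrt_le_iff.2 ⟨by positivity, ?_⟩
    rw [mul_pow, Real.sq_sqrt hl0]; linarith
  have h3 : τ * √(Real.log T) * √(Real.log (T / Real.log T))
      ≤ τ * √(Real.log T) * (2 * √(Real.log T)) := by gcongr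
  have h4 : τ * √(Real.log T) * (2 * √(Real.log T)) = 2 * (τ * Real.log T) := by
    rw [show τ * √(Real.log T) * (2 * √(Real.log T)) = 2 * (τ * (√(Real.log T) * √(Real.log T)))
      by ring, Real.mul_self_sqrt hl0]
  nlinarith

theorem log_one_div_mem {T : ℕ} (hT : 2 ≤ T) {δ : ℝ} (h1 : Real.exp (-(T : ℝ) / 2) < δ)
    (h2 : δ < 1 / (T : ℝ)) :
    Real.log T ≤ Real.log (1 / δ) ∧ Real.log (1 / δ) ≤ T / 2 ∧
      Real.exp (-Real.log (1 / δ)) = δ := by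
  have hT' : (0 : ℝ) < T := by exact_mod_cast (by omega : 0 < T)
  have hδ : 0 < δ := (Real.exp_pos _).trans h1
  refine ⟨Real.log_le_log hT' ?_, ?_, ?_⟩
  · rw [le_div_iff₀ hδ]
    rw [lt_div_iff₀ hT'] at h2
    linarith
  · have := (Real.lt_log_iff_exp_lt hδ).2 h1
    rw [one_div, Real.log_inv]; linarith
  · rw [one_div, Real.log_inv, neg_neg, Real.exp_log hδ]

end

end SoftBinned

theorem theorem6p1 :
    ∃ C : ℝ, 0 < C ∧
      ∀ (D : MeasureTheory.Measure SoftBinned.Pair) [MeasureTheory.IsProbabilityMeasure D]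
        (T : ℕ), 2 ≤ T →
        -- high-probability bound
        (∀ δ : ℝ, Real.exp (-(T : ℝ) / 2) < δ → δ < 1 / (T : ℝ) →
          1 - δ ≤ (SoftBinned.iidLaw D T).real
            {x | |SoftBinned.SCDL (SoftBinned.empirical x) - SoftBinned.SCDL D| ≤
              C * (Real.sqrt (Real.log (1 / δ) / T) * Real.log (T / Real.log (1 / δ)))}) ∧
        -- improved high-probability bound
        (SoftBinned.SCDL D = 0 →
          ∀ δ : ℝ, Real.exp (-(T : ℝ) / 2) < δ → δ < 1 / (T : ℝ) →
            1 - δ ≤ (SoftBinned.iidLaw D T).real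
              {x | SoftBinned.SCDL (SoftBinned.empirical x) ≤
                C * Real.sqrt (Real.log (1 / δ) / T * Real.log (T / Real.log (1 / δ)))}) ∧
        -- bounds in expectation
        MeasureTheory.Integrable
          (fun x => SoftBinned.SCDL (SoftBinned.empirical x)) (SoftBinned.iidLaw D T) ∧
        (∫ x, |SoftBinned.SCDL (SoftBinned.empirical x) - SoftBinned.SCDL D|
            ∂(SoftBinned.iidLaw D T) ≤
          C * ((T : ℝ) ^ (-(1 / 2) : ℝ) * Real.log T ^ (3 / 2 : ℝ))) ∧
        (SoftBinned.SCDL D = 0 →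
          ∫ x, SoftBinned.SCDL (SoftBinned.empirical x) ∂(SoftBinned.iidLaw D T) ≤
            C * ((T : ℝ) ^ (-(1 / 2) : ℝ) * Real.log T)) ∧
        (SoftBinned.IsCalibrated D →
          ∫ x, |SoftBinned.SCDL (SoftBinned.empirical x) - SoftBinned.SCDL D|
              ∂(SoftBinned.iidLaw D T) ≤
            C * ((T : ℝ) ^ (-(1 / 2) : ℝ) * Real.log T)) := by
  refine ⟨30000, by norm_num, fun D _ T hT => ⟨fun δ h1 h2 => ?_, fun hD δ h1 h2 => ?_,
    SoftBinned.integrable_SCDL_empirical D (by omega), SoftBinned.integral_abs_SCDL_sub_le D hT,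
    SoftBinned.integral_SCDL_le_of_SCDL_eq_zero hT, fun hD => ?_⟩⟩
  · obtain ⟨hL1, hL2, hexp⟩ := SoftBinned.log_one_div_mem hT h1 h2
    have h := SoftBinned.concentration (D := D) hT hL1 hL2
    rw [hexp] at h
    have hL0 : 0 < Real.log (1 / δ) := by linarith [SoftBinned.log_natCast_ge hT]
    have hΛ : 0 ≤ Real.log (T / Real.log (1 / δ)) :=
      (Real.log_nonneg one_le_two).trans (SoftBinned.log_two_le_log_div hL0 hL2)
    refine h.trans (MeasureTheory.measureReal_mono (fun x hx => ?_))
    simp only [Set.mem_ofPred_eq] at hx ⊢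
    exact hx.trans (mul_le_mul_of_nonneg_right (by norm_num) (by positivity))
  · obtain ⟨hL1, hL2, hexp⟩ := SoftBinned.log_one_div_mem hT h1 h2
    have h := SoftBinned.concentration_of_SCDL_eq_zero (D := D) hT hL1 hL2 hD
    rw [hexp] at h
    refine h.trans (MeasureTheory.measureReal_mono (fun x hx => ?_))
    simp only [Set.mem_ofPred_eq] at hx ⊢
    exact hx.trans (mul_le_mul_of_nonneg_right (by norm_num) (by positivity))
  · have h0 := SoftBinned.SCDL_eq_zero_of_isCalibrated hD
    have h := SoftBinned.integral_SCDL_le_of_SCDL_eq_zero hT h0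
    simpa only [h0, sub_zero, abs_of_nonneg (SoftBinned.SCDL_nonneg _)] using h
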